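/- All vector spaces are over $\mathbb{Q}$. For a finite-dimensional graded vector space $V$, let $\widehat{\mathbb{L}}(V)$ be the complete free graded Lie algebra on $V$: its degree $p$ part consists of the formal series $\sum_{n\ge 1} f_n$ with $f_n\in\mathbb{L}^n(V)_p$, where $\mathbb{L}^n(V)_p$ is the degree $p$ part of the span of the $n$-fold brackets in the free graded Lie algebra $\mathbb{L}(V)$. A complete free DGL is such a Lie algebra with a linear derivation $\partial$ of degree $-1$ satisfying $\partial^2=0$. A Maurer--Cartan element is an element $a$ of degree $-1$ with $\partial a+\frac12[a,a]=0$; for such an $a$, $\partial_a=\partial+\mathrm{ad}_a$ is again a differential. For $n\ge 0$ let $\widehat{\mathbb{L}}(\Delta^n)$ be the complete free graded Lie algebra on generators $a_{i_0\dots i_p}$ of degree $p-1$, one for each $p$-simplex $(i_0<\dots<i_p)$ of the standard simplex $\Delta^n$ with vertices $0,\dots,n$. Let $\{\mathfrak{L}_n=(\widehat{\mathbb{L}}(\Delta^n),\partial)\}_{n\ge 0}$ be any sequence of compatible models of the standard simplices, that is, a sequence of complete free DGLs such that 1. each vertex generator $a_i$ is a Maurer--Cartan element; 2. the linear part of $\partial$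 is the simplicial boundary, $\partial_1 a_{i_0\dots i_p}=\sum_{j=0}^p(-1)^j a_{i_0\dots\widehat{i_j}\dots i_p}$ for $p\ge 1$, and $\partial_1a_i=0$; 3. the Lie algebra morphisms $\widehat{\mathbb{L}}(\Delta^{n-1})\to\widehat{\mathbb{L}}(\Delta^{n})$ induced on generators by the cofaces $\Delta^{n-1}\to\Delta^n$ commute with the differentials. For a finite simplicial complex $K$, regarded as a subcomplex $K\subseteq\Delta^n$ for some $n$, let $\mathfrak{L}(K)=(\widehat{\mathbb{L}}(V_K),\partial)\subseteq\mathfrak{L}_n$ be the complete sub DGL on the span $V_K$ of the generators given by the simplices of $K$. **Proposition.** Let $K$ be a finite simplicial complex and let $a$ be a vertex of $K$. Denote also by $a$ the corresponding generator of degree $-1$ of $\mathfrak{L}(K)$, and let $K_a\subseteq K$ be the path component of $a$. Then the inclusion $$(\mathfrak{L}(K_a),\partial_a)\hookrightarrow(\mathfrak{L}(K),\partial_a)$$ is a quasi-isomorphism of differential graded Lie algebras, i.e. it induces an isomorphism in homology in every degree. -/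

import Mathlib

open CategoryTheory

noncomputable section

/-! ### Noncommutative power series: the complete tensor algebra on a graded set of generators -/

/-- Noncommutative formal power series over `ℚ` in the letters `X`; the value at a word is the
coefficient of that word. For finite `X` this is `∏ n, T^n(V)`, where `V` is the rational vector
space with basis `X`. -/
def NCSeries (X : Type) : Type := List X → ℚ

namespace NCSeries

variable {X Y : Type}

instance : AddCommGroup (NCSeries X) := inferInstanceAs (AddCommGroup (List X → ℚ))

instance : Module ℚ (NCSeries X) := inferInstanceAs (Module ℚ (List X → ℚ))

@[ext]
theorem ext {f g : NCSeries X} (h : ∀ w, f w = g w) : f = g := funext h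

@[simp] theorem add_apply (f g : NCSeries X) (w : List X) : (f + g) w = f w + g w := rfl
@[simp] theorem sub_apply (f g : NCSeries X) (w : List X) : (f - g) w = f w - g w := rfl
@[simp] theorem zero_apply (w : List X) : (0 : NCSeries X) w = 0 := rfl
@[simp] theorem smul_apply (c : ℚ) (f : NCSeries X) (w : List X) : (c • f) w = c * f w := rfl

theorem sum_apply {ι : Type} (s : Finset ι) (f : ι → NCSeries X) (w : List X) :
    (∑ i ∈ s, f i) w = ∑ i ∈ s, f i w := Finset.sum_apply (M := fun _ : List X => ℚ) w s f

/-- Concatenation product: `(f * g) w` sums `f u * g v` over the factorisations `w = u ++ v`. -/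
instance : Mul (NCSeries X) where
  mul f g := fun w => ∑ i ∈ Finset.range (w.length + 1), f (w.take i) * g (w.drop i)

theorem mul_apply (f g : NCSeries X) (w : List X) :
    (f * g) w = ∑ i ∈ Finset.range (w.length + 1), f (w.take i) * g (w.drop i) := rfl

theorem mul_cons (f g : NCSeries X) (x : X) (w : List X) :
    (f * g) (x :: w) =
      f [] * g (x :: w) + ((show NCSeries X from fun u => f (x :: u)) * g) w := by
  simp only [mul_apply, List.length_cons]
  rw [Finset.sum_range_succ', add_comm]
  rfl

theorem mul_nil (f g : NCSeries X) : (f * g) [] = f [] * g [] := by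
  simp [mul_apply]

theorem mul_add' (f g h : NCSeries X) : f * (g + h) = f * g + f * h := by
  ext w; simp [mul_apply, mul_add, Finset.sum_add_distrib]

theorem add_mul' (f g h : NCSeries X) : (f + g) * h = f * h + g * h := by
  ext w; simp [mul_apply, add_mul, Finset.sum_add_distrib]

theorem smul_mul' (c : ℚ) (f g : NCSeries X) : (c • f) * g = c • (f * g) := by
  ext w; simp [mul_apply, Finset.mul_sum, mul_assoc]

theorem mul_smul' (c : ℚ) (f g : NCSeries X) : f * (c • g) = c • (f * g) := by
  ext w; simp [mul_apply, Finset.mul_sum, mul_left_comm]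

theorem mul_assoc' (f g h : NCSeries X) : f * g * h = f * (g * h) := by
  ext w
  induction w generalizing f with
  | nil => simp [mul_nil, mul_assoc]
  | cons x w ih =>
    rw [mul_cons, mul_cons f, ← ih]
    have : (show NCSeries X from fun u => (f * g) (x :: u)) =
        f [] • (show NCSeries X from fun u => g (x :: u)) +
          (show NCSeries X from fun u => f (x :: u)) * g := by
      ext u
      exact mul_cons f g x u
    rw [this, add_mul', smul_mul', mul_nil, mul_cons g]
    simp only [add_apply, smul_apply]
    ring

instance : NonUnitalRing (NCSeries X) where
  left_distrib := mul_add'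
  right_distrib := add_mul'
  zero_mul f := by ext w; simp [mul_apply]
  mul_zero f := by ext w; simp [mul_apply]
  mul_assoc := mul_assoc'

instance : IsScalarTower ℚ (NCSeries X) (NCSeries X) := ⟨fun c f g => smul_mul' c f g⟩

instance : SMulCommClass ℚ (NCSeries X) (NCSeries X) := ⟨fun c f g => (mul_smul' c f g).symm⟩

open scoped Classical in
/-- The generator `x`. -/
def letter (x : X) : NCSeries X := fun w => if w = [x] then 1 else 0

/-- The part of a series supported on words of length `n`. -/
def lengthPart (n : ℕ) : NCSeries X →ₗ[ℚ] NCSeries X where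
  toFun f := fun w => if w.length = n then f w else 0
  map_add' f g := by
    ext w
    show (if w.length = n then f w + g w else 0) =
      (if w.length = n then f w else 0) + (if w.length = n then g w else 0)
    split_ifs <;> simp
  map_smul' c f := by
    ext w
    show (if w.length = n then c * f w else 0) = c * (if w.length = n then f w else 0)
    split_ifs <;> simp

theorem lengthPart_apply (n : ℕ) (f : NCSeries X) (w : List X) :
    lengthPart n f w = if w.length = n then f w else 0 := rfl

theorem lengthPart_lengthPart (m n : ℕ) (f : NCSeries X) :
    lengthPart m (lengthPart n f) = if m = n then lengthPart n f else 0 := by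
  ext w
  by_cases h : m = n
  · subst h; by_cases h' : w.length = m <;> simp [lengthPart_apply, h']
  · rw [if_neg h]
    by_cases h' : w.length = m
    · simp [lengthPart_apply, h', h]
    · simp [lengthPart_apply, h']

theorem ext_lengthPart {f g : NCSeries X} (h : ∀ n, lengthPart n f = lengthPart n g) : f = g := by
  ext w
  have := congrFun (h w.length) w
  simpa [lengthPart_apply] using this

theorem lengthPart_letter (n : ℕ) (x : X) :
    lengthPart n (letter x) = if n = 1 then letter x else 0 := by
  ext w
  rw [lengthPart_apply]
  by_cases h : n = 1 <;> by_cases hw : w = [x] <;> simp [letter, h, hw]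
  exact fun h' => h h'.symm

theorem lengthPart_mul (n : ℕ) (f g : NCSeries X) :
    lengthPart n (f * g) =
      ∑ ij ∈ Finset.HasAntidiagonal.antidiagonal n, lengthPart ij.1 f * lengthPart ij.2 g := by
  ext w
  rw [sum_apply, lengthPart_apply]
  by_cases h : w.length = n
  · rw [if_pos h, Finset.Nat.sum_antidiagonal_eq_sum_range_succ_mk, mul_apply, h]
    refine Finset.sum_congr rfl fun i hi => ?_
    rw [Finset.mem_range] at hi
    rw [mul_apply, Finset.sum_eq_single i]
    · simp [lengthPart_apply, h]; intro h'; omega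
    · intro j hj hji
      rw [Finset.mem_range] at hj
      rw [lengthPart_apply, if_neg, zero_mul]
      simp; omega
    · intro h'; exact absurd (Finset.mem_range.2 (h ▸ hi)) h'
  · rw [if_neg h]
    symm
    refine Finset.sum_eq_zero fun ij hij => ?_
    rw [Finset.HasAntidiagonal.mem_antidiagonal] at hij
    rw [mul_apply]
    refine Finset.sum_eq_zero fun i hi => ?_
    rw [Finset.mem_range] at hi
    by_cases h1 : i = ij.1
    · rw [lengthPart_apply ij.2, if_neg, mul_zero]
      simp; omega
    · rw [lengthPart_apply, if_neg, zero_mul]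
      simp; omega

/-- The graded commutator `[f, g] = f g - (-1)^{p q} g f` of series of degrees `p` and `q`. -/
def bracket (p q : ℤ) (f g : NCSeries X) : NCSeries X := f * g - (-1 : ℚ) ^ (p * q) • (g * f)

theorem bracket_add (p q : ℤ) (f g h : NCSeries X) :
    bracket p q f (g + h) = bracket p q f g + bracket p q f h := by
  simp only [bracket, mul_add, add_mul, smul_add]; abel

theorem add_bracket (p q : ℤ) (f g h : NCSeries X) :
    bracket p q (f + g) h = bracket p q f h + bracket p q g h := by
  simp only [bracket, mul_add, add_mul, smul_add]; abel

theorem bracket_smul (p q : ℤ) (c : ℚ) (f g : NCSeries X) :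
    bracket p q f (c • g) = c • bracket p q f g := by
  simp only [bracket, mul_smul_comm, smul_mul_assoc, smul_sub, smul_comm c]

theorem smul_bracket (p q : ℤ) (c : ℚ) (f g : NCSeries X) :
    bracket p q (c • f) g = c • bracket p q f g := by
  simp only [bracket, mul_smul_comm, smul_mul_assoc, smul_sub, smul_comm c]

theorem bracket_zero (p q : ℤ) (f : NCSeries X) : bracket p q f 0 = 0 := by simp [bracket]

theorem zero_bracket (p q : ℤ) (f : NCSeries X) : bracket p q 0 f = 0 := by simp [bracket]

theorem neg_one_zpow_mul_self (n : ℤ) : (-1 : ℚ) ^ n * (-1 : ℚ) ^ n = 1 := by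
  rw [← mul_zpow]; simp

/-- The graded Jacobi identity. -/
theorem jacobi (p q r : ℤ) (f g h : NCSeries X) :
    bracket (p + q) r (bracket p q f g) h =
      bracket p (q + r) f (bracket q r g h) -
        (-1 : ℚ) ^ (p * q) • bracket q (p + r) g (bracket p r f h) := by
  have h0 : (-1 : ℚ) ≠ 0 := by norm_num
  have e1 : (-1 : ℚ) ^ ((p + q) * r) = (-1) ^ (p * r) * (-1) ^ (q * r) := by
    rw [add_mul, zpow_add₀ h0]
  have e2 : (-1 : ℚ) ^ (p * (q + r)) = (-1) ^ (p * q) * (-1) ^ (p * r) := by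
    rw [mul_add, zpow_add₀ h0]
  have e3 : (-1 : ℚ) ^ (q * (p + r)) = (-1) ^ (p * q) * (-1) ^ (q * r) := by
    rw [mul_add, zpow_add₀ h0, mul_comm q p]
  have hs := neg_one_zpow_mul_self (p * q)
  simp only [bracket, e1, e2, e3]
  generalize (-1 : ℚ) ^ (p * q) = s at *
  generalize (-1 : ℚ) ^ (p * r) = t at *
  generalize (-1 : ℚ) ^ (q * r) = u at *
  simp only [mul_sub, sub_mul, mul_smul_comm, smul_mul_assoc, smul_sub, smul_smul, mul_assoc]
  have h1 : s * (s * u) = u := by rw [← mul_assoc, hs, one_mul]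
  have h2 : s * (s * (u * t)) = u * t := by rw [← mul_assoc, hs, one_mul]
  simp only [h1, h2]
  module

theorem lengthPart_bracket (n : ℕ) (p q : ℤ) (f g : NCSeries X) :
    lengthPart n (bracket p q f g) =
      ∑ ij ∈ Finset.HasAntidiagonal.antidiagonal n, bracket p q (lengthPart ij.1 f) (lengthPart ij.2 g) := by
  simp only [bracket, Finset.sum_sub_distrib, map_sub, map_smul, lengthPart_mul,
    ← Finset.smul_sum]
  congr 2
  exact (Finset.Nat.sum_antidiagonal_swap (n := n)
    (f := fun ij : ℕ × ℕ => lengthPart ij.1 g * lengthPart ij.2 f)).symm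

/-- Renaming of letters along an injective map `φ`: the word `x₁ ⋯ xₙ` goes to
`φ x₁ ⋯ φ xₙ`. -/
def rename (φ : X ↪ Y) : NCSeries X →ₗ[ℚ] NCSeries Y :=
  show (List X → ℚ) →ₗ[ℚ] (List Y → ℚ) from
    Function.ExtendByZero.linearMap ℚ (List.map φ : List X → List Y)

theorem rename_map (φ : X ↪ Y) (f : NCSeries X) (u : List X) :
    rename φ f (u.map φ) = f u :=
  (List.map_injective_iff.2 φ.injective).extend_apply (f : List X → ℚ) (0 : List Y → ℚ) u

theorem rename_of_not (φ : X ↪ Y) (f : NCSeries X) (w : List Y)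
    (h : ¬ ∃ u : List X, u.map φ = w) : rename φ f w = 0 :=
  Function.extend_apply' (f : List X → ℚ) (0 : List Y → ℚ) w h

theorem rename_mul (φ : X ↪ Y) (f g : NCSeries X) :
    rename φ (f * g) = rename φ f * rename φ g := by
  ext w
  by_cases h : ∃ u : List X, u.map φ = w
  · obtain ⟨u, rfl⟩ := h
    rw [rename_map, mul_apply, mul_apply, List.length_map]
    refine Finset.sum_congr rfl fun i _ => ?_
    rw [← List.map_take, ← List.map_drop, rename_map, rename_map]
  · rw [rename_of_not _ _ _ h, mul_apply]
    symm
    refine Finset.sum_eq_zero fun i _ => ?_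
    by_cases h1 : ∃ u : List X, u.map φ = w.take i
    · rw [rename_of_not φ g, mul_zero]
      rintro ⟨v, hv⟩
      obtain ⟨u, hu⟩ := h1
      exact h ⟨u ++ v, by rw [List.map_append, hu, hv, List.take_append_drop]⟩
    · rw [rename_of_not φ f _ h1, zero_mul]

theorem rename_bracket (φ : X ↪ Y) (p q : ℤ) (f g : NCSeries X) :
    rename φ (bracket p q f g) = bracket p q (rename φ f) (rename φ g) := by
  simp only [bracket, map_sub, map_smul, rename_mul]

theorem rename_letter (φ : X ↪ Y) (x : X) : rename φ (letter x) = letter (φ x) := by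
  ext w
  by_cases h : ∃ u : List X, u.map φ = w
  · obtain ⟨u, rfl⟩ := h
    rw [rename_map]
    have : u.map φ = [φ x] ↔ u = [x] := by
      rw [← (List.map_injective_iff.2 φ.injective).eq_iff (a := u) (b := [x])]; simp
    classical
    simp only [letter]
    exact if_congr this.symm rfl rfl
  · rw [rename_of_not _ _ _ h, letter, if_neg]
    rintro rfl
    exact h ⟨[x], rfl⟩

theorem lengthPart_rename (φ : X ↪ Y) (n : ℕ) (f : NCSeries X) :
    lengthPart n (rename φ f) = rename φ (lengthPart n f) := by
  ext w
  by_cases h : ∃ u : List X, u.map φ = w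
  · obtain ⟨u, rfl⟩ := h
    simp [lengthPart_apply, rename_map]
  · simp [lengthPart_apply, rename_of_not _ _ _ h]

end NCSeries

open NCSeries

/-! ### Free graded Lie algebras and their completions -/

variable {X Y : Type}

/-- Iterated brackets of `n` of the generators `x ∈ S`, of total degree `p`. -/
inductive IsLieMonomial (deg : X → ℤ) (S : Set X) : ℕ → ℤ → NCSeries X → Prop
  | of (x : X) (hx : x ∈ S) : IsLieMonomial deg S 1 (deg x) (letter x)
  | bracket {m n : ℕ} {p q : ℤ} {f g : NCSeries X} (hf : IsLieMonomial deg S m p f)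
      (hg : IsLieMonomial deg S n q g) :
      IsLieMonomial deg S (m + n) (p + q) (bracket p q f g)

/-- `𝕃ⁿ(V)_p`, where `𝕃(V)` is the free graded Lie algebra on the graded vector space `V` with
basis `S`, realised as the graded Lie subalgebra of the tensor algebra generated by `V`. -/
def freeLie (deg : X → ℤ) (S : Set X) (n : ℕ) (p : ℤ) : Submodule ℚ (NCSeries X) :=
  Submodule.span ℚ {f | IsLieMonomial deg S n p f}

/-- The degree `p` part of the complete free graded Lie algebra `𝕃̂(V)` on the graded vector
space `V` with finite basis `S`: formal series `∑ n, fₙ` with `fₙ ∈ 𝕃ⁿ(V)_p`. -/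
def completeFreeLie (deg : X → ℤ) (S : Set X) (p : ℤ) : Submodule ℚ (NCSeries X) where
  carrier := {f | ∀ n, lengthPart n f ∈ freeLie deg S n p}
  add_mem' hf hg n := by rw [map_add]; exact add_mem (hf n) (hg n)
  zero_mem' n := by rw [map_zero]; exact zero_mem _
  smul_mem' c f hf n := by rw [map_smul]; exact Submodule.smul_mem _ c (hf n)

theorem freeLie_mono (deg : X → ℤ) {S T : Set X} (h : S ⊆ T) (n : ℕ) (p : ℤ) :
    freeLie deg S n p ≤ freeLie deg T n p := by
  refine Submodule.span_mono fun f hf => ?_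
  have hf' : IsLieMonomial deg S n p f := hf
  show IsLieMonomial deg T n p f
  clear hf
  induction hf' with
  | of x hx => exact .of x (h hx)
  | bracket _ _ h1 h2 => exact .bracket h1 h2

theorem completeFreeLie_mono (deg : X → ℤ) {S T : Set X} (h : S ⊆ T) (p : ℤ) :
    completeFreeLie deg S p ≤ completeFreeLie deg T p :=
  fun _ hf n => freeLie_mono deg h n p (hf n)

theorem lengthPart_of_mem_freeLie {deg : X → ℤ} {S : Set X} {n : ℕ} {p : ℤ} {f : NCSeries X}
    (hf : f ∈ freeLie deg S n p) (m : ℕ) : lengthPart m f = if m = n then f else 0 := by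
  induction hf using Submodule.span_induction with
  | mem f hf =>
    have hf' : IsLieMonomial deg S n p f := hf
    clear hf
    induction hf' generalizing m with
    | of x hx => exact lengthPart_letter m x
    | @bracket k l p q f g _ _ h1 h2 =>
      rw [lengthPart_bracket]
      by_cases h : m = k + l
      · rw [if_pos h, Finset.sum_eq_single (k, l)]
        · rw [h1, h2, if_pos rfl, if_pos rfl]
        · rintro ⟨i, j⟩ _ hij
          rw [h1, h2]
          by_cases hi : i = k
          · rw [if_neg (fun hj : j = l => hij (by rw [hi, hj])), bracket_zero]
          · rw [if_neg hi, zero_bracket]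
        · intro h'; exact absurd (Finset.HasAntidiagonal.mem_antidiagonal.2 h.symm) h'
      · rw [if_neg h]
        refine Finset.sum_eq_zero fun ij hij => ?_
        rw [Finset.HasAntidiagonal.mem_antidiagonal] at hij
        rw [h1, h2]
        by_cases hi : ij.1 = k
        · rw [if_neg (fun hj : ij.2 = l => h (by omega)), bracket_zero]
        · rw [if_neg hi, zero_bracket]
  | zero => simp
  | add f g _ _ h1 h2 => rw [map_add, h1, h2]; split_ifs <;> simp
  | smul c f _ h => rw [map_smul, h]; split_ifs <;> simp

theorem freeLie_le_completeFreeLie (deg : X → ℤ) (S : Set X) (n : ℕ) (p : ℤ) :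
    freeLie deg S n p ≤ completeFreeLie deg S p := by
  intro f hf m
  rw [lengthPart_of_mem_freeLie hf]
  split_ifs with h
  · rwa [h]
  · exact zero_mem _

theorem letter_mem {deg : X → ℤ} {S : Set X} {x : X} (hx : x ∈ S) {p : ℤ} (hp : deg x = p) :
    letter x ∈ completeFreeLie deg S p :=
  freeLie_le_completeFreeLie deg S 1 p (Submodule.subset_span (hp ▸ .of x hx))

theorem bracket_mem_freeLie {deg : X → ℤ} {S : Set X} {m n : ℕ} {p q : ℤ} {f g : NCSeries X}
    (hf : f ∈ freeLie deg S m p) (hg : g ∈ freeLie deg S n q) :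
    bracket p q f g ∈ freeLie deg S (m + n) (p + q) := by
  induction hf using Submodule.span_induction with
  | mem f hf =>
    induction hg using Submodule.span_induction with
    | mem g hg => exact Submodule.subset_span (.bracket hf hg)
    | zero => rw [bracket_zero]; exact zero_mem _
    | add g h _ _ h1 h2 => rw [bracket_add]; exact add_mem h1 h2
    | smul c g _ h => rw [bracket_smul]; exact Submodule.smul_mem _ c h
  | zero => rw [zero_bracket]; exact zero_mem _
  | add g h _ _ h1 h2 => rw [add_bracket]; exact add_mem h1 h2
  | smul c g _ h => rw [smul_bracket]; exact Submodule.smul_mem _ c h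

theorem bracket_mem {deg : X → ℤ} {S : Set X} {p q : ℤ} {f g : NCSeries X}
    (hf : f ∈ completeFreeLie deg S p) (hg : g ∈ completeFreeLie deg S q) :
    bracket p q f g ∈ completeFreeLie deg S (p + q) := by
  intro n
  rw [lengthPart_bracket]
  refine Submodule.sum_mem _ fun ij hij => ?_
  rw [← Finset.HasAntidiagonal.mem_antidiagonal.1 hij]
  exact bracket_mem_freeLie (hf ij.1) (hg ij.2)

theorem rename_mem {degX : X → ℤ} {degY : Y → ℤ} {S : Set X} {T : Set Y} (φ : X ↪ Y)
    (hdeg : ∀ x, degY (φ x) = degX x) (hS : ∀ x ∈ S, φ x ∈ T) {p : ℤ} {f : NCSeries X}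
    (hf : f ∈ completeFreeLie degX S p) : rename φ f ∈ completeFreeLie degY T p := by
  intro n
  rw [lengthPart_rename]
  have key : ∀ g ∈ freeLie degX S n p, rename φ g ∈ freeLie degY T n p := by
    intro g hg
    induction hg using Submodule.span_induction with
    | mem g hg =>
      refine Submodule.subset_span ?_
      have hg' : IsLieMonomial degX S n p g := hg
      show IsLieMonomial degY T n p _
      clear hg hf
      induction hg' with
      | of x hx => rw [rename_letter, ← hdeg]; exact .of _ (hS x hx)
      | bracket _ _ h1 h2 => rw [rename_bracket]; exact .bracket h1 h2
    | zero => rw [map_zero]; exact zero_mem _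
    | add g h _ _ h1 h2 => rw [map_add]; exact add_mem h1 h2
    | smul c g _ h => rw [map_smul]; exact Submodule.smul_mem _ c h
  exact key _ (hf n)

/-! ### Complete free differential graded Lie algebras -/

/-- A differential on the complete free graded Lie algebra `𝕃̂(V)`, `V` with basis `S`: a linear
derivation of degree `-1` and square zero. -/
structure CompleteFreeDGL (deg : X → ℤ) (S : Set X) where
  d : ∀ p : ℤ, completeFreeLie deg S p →ₗ[ℚ] completeFreeLie deg S (p - 1)
  leibniz : ∀ (p q : ℤ) (x : completeFreeLie deg S p) (y : completeFreeLie deg S q),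
    (d (p + q) ⟨bracket p q x.1 y.1, bracket_mem x.2 y.2⟩ : NCSeries X) =
      bracket (p - 1) q (d p x).1 y.1 + (-1 : ℚ) ^ p • bracket p (q - 1) x.1 (d q y).1
  d_d : ∀ (p : ℤ) (x : completeFreeLie deg S p), d (p - 1) (d p x) = 0

namespace CompleteFreeDGL

variable {deg : X → ℤ} {S T : Set X}

theorem d_congr (D : CompleteFreeDGL deg S) {p q : ℤ} (h : p = q) (x : completeFreeLie deg S p)
    (y : completeFreeLie deg S q) (hxy : x.1 = y.1) : (D.d p x).1 = (D.d q y).1 := by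
  subst h
  rw [Subtype.ext hxy]

/-- Maurer-Cartan elements: `a` of degree `-1` with `∂a + ½[a,a] = 0`. -/
def IsMaurerCartan (D : CompleteFreeDGL deg S) (a : completeFreeLie deg S (-1)) : Prop :=
  (D.d (-1) a).1 + (1 / 2 : ℚ) • bracket (-1) (-1) a.1 a.1 = 0

/-- The operator `ad_a`, for `a` of degree `-1`. -/
def ad (a : completeFreeLie deg S (-1)) (p : ℤ) :
    completeFreeLie deg S p →ₗ[ℚ] completeFreeLie deg S (p - 1) where
  toFun x := ⟨bracket (-1) p a.1 x.1, by
    rw [show p - 1 = -1 + p by ring]; exact bracket_mem a.2 x.2⟩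
  map_add' x y := Subtype.ext (bracket_add _ _ _ _ _)
  map_smul' c x := Subtype.ext (bracket_smul _ _ _ _ _)

/-- The DGL `(L, ∂_a)` with `∂_a = ∂ + ad_a`, for a Maurer-Cartan element `a`. -/
def twist (D : CompleteFreeDGL deg S) (a : completeFreeLie deg S (-1))
    (ha : D.IsMaurerCartan a) : CompleteFreeDGL deg S where
  d p := D.d p + ad a p
  leibniz p q x y := by
    have h := D.leibniz p q x y
    have hj := jacobi (-1) p q a.1 x.1 y.1
    have e : (-1 : ℚ) ^ (-1 * p) = (-1) ^ p := by
      rw [neg_one_mul, zpow_neg, ← inv_zpow]; norm_num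
    rw [e] at hj
    simp only [LinearMap.add_apply, Submodule.coe_add, ad, LinearMap.coe_mk, AddHom.coe_mk, h,
      add_bracket, bracket_add, smul_add]
    rw [show bracket (p - 1) q (bracket (-1) p a.1 x.1) y.1 = _ from
        (congrArg (fun r => bracket r q (bracket (-1) p a.1 x.1) y.1)
          (show p - 1 = -1 + p by ring)).trans hj,
      show bracket p (q - 1) x.1 (bracket (-1) q a.1 y.1) = _ from
        congrArg (fun r => bracket p r x.1 (bracket (-1) q a.1 y.1))
          (show q - 1 = -1 + q by ring)]
    abel
  d_d p x := by
    apply Subtype.ext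
    have h1 : (D.d (p - 1) (ad a p x)).1 = _ :=
      (D.d_congr (by ring) (ad a p x) ⟨bracket (-1) p a.1 x.1, bracket_mem a.2 x.2⟩ rfl).trans
        (D.leibniz (-1) p a x)
    have hmc : (D.d (-1) a).1 = -(1 / 2 : ℚ) • bracket (-1) (-1) a.1 a.1 := by
      have := eq_neg_of_add_eq_zero_left ha
      rw [this, neg_smul]
    have hj := jacobi (-1) (-1) p a.1 a.1 x.1
    simp only [LinearMap.add_apply, map_add, D.d_d, zero_add, Submodule.coe_add, h1]
    rw [hmc, smul_bracket]
    simp only [ad, LinearMap.coe_mk, AddHom.coe_mk, Submodule.coe_zero]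
    rw [show bracket (-1 - 1) p (bracket (-1) (-1) a.1 a.1) x.1 = _ from hj,
      show bracket (-1) (p - 1) a.1 (bracket (-1) p a.1 x.1) = _ from
        congrArg (fun r => bracket (-1) r a.1 (bracket (-1) p a.1 x.1))
          (show p - 1 = -1 + p by ring)]
    norm_num
    module

/-- The underlying chain complex. -/
def chainComplex (D : CompleteFreeDGL deg S) : ChainComplex (ModuleCat ℚ) ℤ where
  X p := ModuleCat.of ℚ (completeFreeLie deg S p)
  d p q := if h : q + 1 = p then
      ModuleCat.ofHom (LinearMap.codRestrict (completeFreeLie deg S q)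
        ((completeFreeLie deg S (p - 1)).subtype ∘ₗ D.d p)
        (fun x => by
          have e : q = p - 1 := by omega
          subst e
          exact (D.d p x).2))
    else 0
  shape p q h := dif_neg h
  d_comp_d' p q r h1 h2 := by
    have e1 : q = p - 1 := by simp at h1; omega
    subst e1
    have e2 : r = p - 1 - 1 := by simp at h2; omega
    subst e2
    rw [dif_pos (by ring), dif_pos (by ring)]
    apply ModuleCat.hom_ext
    apply LinearMap.ext
    intro x
    exact D.d_d p x

/-- A homomorphism of DGLs. -/
structure Hom {degX : X → ℤ} {degY : Y → ℤ} {S : Set X} {T : Set Y}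
    (D : CompleteFreeDGL degX S) (E : CompleteFreeDGL degY T) where
  toFun : ∀ p : ℤ, completeFreeLie degX S p →ₗ[ℚ] completeFreeLie degY T p
  map_bracket : ∀ (p q : ℤ) (x : completeFreeLie degX S p) (y : completeFreeLie degX S q),
    (toFun (p + q) ⟨bracket p q x.1 y.1, bracket_mem x.2 y.2⟩).1 =
      bracket p q (toFun p x).1 (toFun q y).1
  map_d : ∀ (p : ℤ) (x : completeFreeLie degX S p), toFun (p - 1) (D.d p x) = E.d p (toFun p x)

/-- The underlying chain map of a homomorphism of DGLs. -/
def Hom.chainMap {degX : X → ℤ} {degY : Y → ℤ} {S : Set X} {T : Set Y}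
    {D : CompleteFreeDGL degX S} {E : CompleteFreeDGL degY T} (φ : Hom D E) :
    D.chainComplex ⟶ E.chainComplex where
  f p := ModuleCat.ofHom (φ.toFun p)
  comm' p q h := by
    have e : q = p - 1 := by simp at h; omega
    subst e
    dsimp only [chainComplex]
    rw [dif_pos (by ring), dif_pos (by ring)]
    apply ModuleCat.hom_ext
    apply LinearMap.ext
    intro x
    exact (φ.map_d p x).symm

/-- A quasi-isomorphism of DGLs: a homomorphism inducing isomorphisms in homology. -/
def Hom.IsQuasiIso {degX : X → ℤ} {degY : Y → ℤ} {S : Set X} {T : Set Y}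
    {D : CompleteFreeDGL degX S} {E : CompleteFreeDGL degY T} (φ : Hom D E) : Prop :=
  QuasiIso φ.chainMap

/-- The inclusion `𝕃̂(V) ⊆ 𝕃̂(W)`, for spans `V ⊆ W` of generators, as a homomorphism of DGLs when
the differentials agree. -/
def inclusion (D : CompleteFreeDGL deg S) (E : CompleteFreeDGL deg T) (h : S ⊆ T)
    (hd : ∀ (p : ℤ) (x : completeFreeLie deg S p),
      (D.d p x).1 = (E.d p ⟨x.1, completeFreeLie_mono deg h p x.2⟩).1) : Hom D E where
  toFun p := Submodule.inclusion (completeFreeLie_mono deg h p)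
  map_bracket _ _ _ _ := rfl
  map_d p x := Subtype.ext (hd p x)

/-! Every differential preserves the filtration by bracket length, hence the complete Lie
subalgebra generated by a set `T` of generators with `∂T ⊆ 𝕃̂(T)`. -/

theorem exists_sum_bracket [Fintype X] {n : ℕ} (hn : 2 ≤ n) {p : ℤ} {f : NCSeries X}
    (hf : f ∈ freeLie deg Set.univ n p) :
    ∃ g : X → NCSeries X, (∀ x, g x ∈ freeLie deg Set.univ (n - 1) (p - deg x)) ∧
      f = ∑ x, bracket (deg x) (p - deg x) (letter x) (g x) := by
  classical
  let R : ℕ → ℤ → Submodule ℚ (NCSeries X) := fun n p =>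
    { carrier := {f | ∃ g : X → NCSeries X,
        (∀ x, g x ∈ freeLie deg Set.univ (n - 1) (p - deg x)) ∧
        f = ∑ x, bracket (deg x) (p - deg x) (letter x) (g x)}
      add_mem' := by
        rintro _ _ ⟨g, hg, rfl⟩ ⟨g', hg', rfl⟩
        exact ⟨g + g', fun x => add_mem (hg x) (hg' x), by
          simp [bracket_add, Finset.sum_add_distrib]⟩
      zero_mem' := ⟨0, fun x => zero_mem _, by simp [bracket_zero]⟩
      smul_mem' := by
        rintro c _ ⟨g, hg, rfl⟩
        exact ⟨c • g, fun x => Submodule.smul_mem _ c (hg x), by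
          simp [bracket_smul, Finset.smul_sum]⟩ }
  have hpos : ∀ {n p f}, IsLieMonomial deg Set.univ n p f → 1 ≤ n := by
    intro n p f hf
    induction hf with
    | of => exact le_rfl
    | bracket _ _ h1 h2 => omega
  have key : ∀ {m p f}, IsLieMonomial deg Set.univ m p f → ∀ {n q g}, 1 ≤ n →
      g ∈ freeLie deg Set.univ n q → bracket p q f g ∈ R (m + n) (p + q) := by
    intro m p f hf
    induction hf with
    | of x _ =>
      intro n q g hn hg
      refine ⟨Pi.single x g, fun y => ?_, ?_⟩
      · by_cases hy : y = x
        · subst hy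
          rw [Pi.single_eq_same, show 1 + n - 1 = n by omega, add_sub_cancel_left]
          exact hg
        · rw [Pi.single_eq_of_ne hy]; exact zero_mem _
      · rw [Finset.sum_eq_single x]
        · rw [Pi.single_eq_same, add_sub_cancel_left]
        · intro y _ hy; rw [Pi.single_eq_of_ne hy, bracket_zero]
        · intro h; exact absurd (Finset.mem_univ x) h
    | @bracket m1 m2 p1 p2 f1 f2 hf1 hf2 ih1 ih2 =>
      intro n q g hn hg
      rw [jacobi]
      refine sub_mem ?_ (Submodule.smul_mem _ _ ?_)
      · have := ih1 (n := m2 + n) (q := p2 + q) (by omega)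
          (bracket_mem_freeLie (Submodule.subset_span hf2) hg)
        rwa [← add_assoc, ← add_assoc] at this
      · have := ih2 (n := m1 + n) (q := p1 + q) (by omega)
          (bracket_mem_freeLie (Submodule.subset_span hf1) hg)
        rwa [show m2 + (m1 + n) = m1 + m2 + n by ring,
          show p2 + (p1 + q) = p1 + p2 + q by ring] at this
  have hR : freeLie deg Set.univ n p ≤ R n p := by
    refine Submodule.span_le.2 fun f hf => ?_
    have hf' : IsLieMonomial deg Set.univ n p f := hf
    cases hf' with
    | of x _ => omega
    | bracket h1 h2 => exact key h1 (hpos h2) (Submodule.subset_span h2)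
  exact hR hf

theorem lengthPart_zero_of_mem {p : ℤ} {f : NCSeries X} (hf : f ∈ completeFreeLie deg S p) :
    lengthPart 0 f = 0 := by
  have key : ∀ {n p g}, IsLieMonomial deg S n p g → 1 ≤ n := by
    intro n p f hf
    induction hf with
    | of => exact le_rfl
    | bracket _ _ h1 h2 => omega
  have : freeLie deg S 0 p = ⊥ := by
    rw [freeLie, Submodule.span_eq_bot]
    intro g hg
    exact absurd (key hg) (by omega)
  simpa [this] using hf 0

theorem lengthPart_d_eq_zero [Fintype X] (D : CompleteFreeDGL deg Set.univ) (N : ℕ) :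
    ∀ (p : ℤ) (x : completeFreeLie deg Set.univ p), (∀ k < N, lengthPart k x.1 = 0) →
      ∀ k < N, lengthPart k (D.d p x).1 = 0 := by
  induction N with
  | zero => intro p x _ k hk; omega
  | succ N ih =>
    intro p x hx k hk
    rcases Nat.eq_zero_or_pos k with rfl | hk0
    · exact lengthPart_zero_of_mem (D.d p x).2
    have hdec : ∀ n, ∃ g : X → NCSeries X,
        (∀ y, g y ∈ freeLie deg Set.univ n (p - deg y)) ∧ (n < N → g = 0) ∧
        (1 ≤ n → lengthPart (n + 1) x.1 =
          ∑ y, bracket (deg y) (p - deg y) (letter y) (g y)) := by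
      intro n
      by_cases hn : n < N
      · refine ⟨0, fun y => zero_mem _, fun _ => rfl, fun _ => ?_⟩
        rw [hx (n + 1) (by omega)]
        simp [bracket_zero]
      · by_cases h1 : 1 ≤ n
        · obtain ⟨g, hg, hg'⟩ := exists_sum_bracket (by omega) (x.2 (n + 1))
          exact ⟨g, hg, fun h => absurd h hn, fun _ => hg'⟩
        · exact ⟨0, fun y => zero_mem _, fun _ => rfl, fun h => absurd h h1⟩
    choose g hg hg0 hgx using hdec
    let G : X → NCSeries X := fun y w => g w.length y w
    have hG : ∀ n y, lengthPart n (G y) = g n y := by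
      intro n y
      have h2 := lengthPart_of_mem_freeLie (hg n y) n
      rw [if_pos rfl] at h2
      rw [← h2]
      ext w
      by_cases h : w.length = n
      · rw [lengthPart_apply, lengthPart_apply, if_pos h, if_pos h]
        show g w.length y w = _
        rw [h]
      · simp [lengthPart_apply, h]
    have hGmem : ∀ y, G y ∈ completeFreeLie deg Set.univ (p - deg y) := by
      intro y n; rw [hG]; exact hg n y
    let L : X → completeFreeLie deg Set.univ p := fun y =>
      ⟨bracket (deg y) (p - deg y) (letter y) (G y), by
        have := bracket_mem (letter_mem (Set.mem_univ y) rfl) (hGmem y)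
        rwa [add_sub_cancel] at this⟩
    have hlb : ∀ (n : ℕ) (r q : ℤ) (y : X) (f : NCSeries X),
        lengthPart (n + 1) (bracket r q (letter y) f) = bracket r q (letter y) (lengthPart n f) := by
      intro n r q y f
      rw [lengthPart_bracket, Finset.sum_eq_single (1, n)]
      · rw [lengthPart_letter, if_pos rfl]
      · rintro ⟨i, j⟩ hij hne
        rw [Finset.HasAntidiagonal.mem_antidiagonal] at hij
        rw [lengthPart_letter, if_neg, zero_bracket]
        rintro rfl
        exact hne (by simp at hij ⊢; omega)
      · intro h; exact absurd (Finset.HasAntidiagonal.mem_antidiagonal.2 (by ring)) h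
    rcases Nat.eq_zero_or_pos N with rfl | hN
    · omega
    have hxL : x = ∑ y, L y := by
      apply Subtype.ext
      rw [Submodule.coe_sum]
      apply ext_lengthPart
      intro n
      rcases Nat.lt_or_ge n 2 with h2 | h2
      · rw [hx n (by omega), map_sum]
        symm
        refine Finset.sum_eq_zero fun y _ => ?_
        rcases n with _ | n
        · exact lengthPart_zero_of_mem (L y).2
        · show lengthPart (n + 1) (bracket _ _ _ _) = 0
          rw [hlb, hG, hg0 n (by omega)]
          simp [bracket_zero]
      · obtain ⟨n, rfl⟩ : ∃ m, n = m + 1 := ⟨n - 1, by omega⟩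
        rw [hgx n (by omega), map_sum]
        refine Finset.sum_congr rfl fun y _ => ?_
        show _ = lengthPart (n + 1) (bracket _ _ _ _)
        rw [hlb, hG]
    rw [hxL, map_sum, Submodule.coe_sum, map_sum]
    refine Finset.sum_eq_zero fun y _ => ?_
    have hl : (D.d p (L y)).1 = _ :=
      (D.d_congr (show p = deg y + (p - deg y) by ring) (L y)
        ⟨_, bracket_mem (letter_mem (Set.mem_univ y) rfl) (hGmem y)⟩ rfl).trans
        (D.leibniz (deg y) (p - deg y) ⟨letter y, letter_mem (Set.mem_univ y) rfl⟩ ⟨G y, hGmem y⟩)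
    have hG0 : ∀ j < N, lengthPart j (G y) = 0 := by
      intro j hj; rw [hG, hg0 j hj]; rfl
    obtain ⟨k, rfl⟩ : ∃ m, k = m + 1 := ⟨k - 1, by omega⟩
    rw [hl, map_add, map_smul, hlb, ih _ ⟨G y, hGmem y⟩ hG0 k (by omega), bracket_zero, smul_zero,
      add_zero, lengthPart_bracket]
    refine Finset.sum_eq_zero fun ij hij => ?_
    rw [Finset.HasAntidiagonal.mem_antidiagonal] at hij
    rcases Nat.eq_zero_or_pos ij.1 with h0 | h0
    · rw [h0, lengthPart_zero_of_mem (D.d _ _).2, zero_bracket]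
    · rw [hG0 ij.2 (by omega), bracket_zero]

theorem d_mem [Fintype X] (D : CompleteFreeDGL deg Set.univ)
    (hT : ∀ x ∈ T, (D.d (deg x) ⟨letter x, letter_mem (Set.mem_univ x) rfl⟩).1 ∈
      completeFreeLie deg T (deg x - 1))
    (p : ℤ) (f : completeFreeLie deg Set.univ p) (hf : f.1 ∈ completeFreeLie deg T p) :
    (D.d p f).1 ∈ completeFreeLie deg T (p - 1) := by
  have hle : ∀ n p, freeLie deg T n p ≤ completeFreeLie deg Set.univ p := fun n p =>
    (freeLie_le_completeFreeLie deg T n p).trans (completeFreeLie_mono deg (Set.subset_univ T) p)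
  have hmono : ∀ {n p g} (hg : IsLieMonomial deg T n p g),
      (D.d p ⟨g, hle n p (Submodule.subset_span hg)⟩).1 ∈ completeFreeLie deg T (p - 1) := by
    intro n p g hg
    induction hg with
    | of x hx => exact hT x hx
    | @bracket m n p q f g hf hg h1 h2 =>
      have hf' := freeLie_le_completeFreeLie deg T m p (Submodule.subset_span hf)
      have hg' := freeLie_le_completeFreeLie deg T n q (Submodule.subset_span hg)
      rw [D.leibniz p q ⟨f, hle m p (Submodule.subset_span hf)⟩
        ⟨g, hle n q (Submodule.subset_span hg)⟩]
      refine add_mem ?_ (Submodule.smul_mem _ _ ?_)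
      · have := bracket_mem h1 hg'
        rwa [show p - 1 + q = p + q - 1 by ring] at this
      · have := bracket_mem hf' h2
        rwa [show p + (q - 1) = p + q - 1 by ring] at this
  have hpoly : ∀ (n : ℕ) (g : completeFreeLie deg Set.univ p), g.1 ∈ freeLie deg T n p →
      (D.d p g).1 ∈ completeFreeLie deg T (p - 1) := by
    rintro n ⟨g, hg'⟩ hg
    dsimp only at hg
    induction hg using Submodule.span_induction with
    | mem g hg => exact hmono hg
    | zero =>
      have : (⟨0, hg'⟩ : completeFreeLie deg Set.univ p) = 0 := rfl
      rw [this, map_zero]; exact zero_mem _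
    | add g h hg hh h1 h2 =>
      have : (⟨g + h, hg'⟩ : completeFreeLie deg Set.univ p) =
        ⟨g, hle n p hg⟩ + ⟨h, hle n p hh⟩ := rfl
      rw [this, map_add]; exact add_mem (h1 _) (h2 _)
    | smul c g hg h =>
      have : (⟨c • g, hg'⟩ : completeFreeLie deg Set.univ p) = c • ⟨g, hle n p hg⟩ := rfl
      rw [this, map_smul]; exact Submodule.smul_mem _ c (h _)
  intro k
  let P : ℕ → completeFreeLie deg Set.univ p := fun i => ⟨lengthPart i f.1, hle i p (hf i)⟩
  let t : completeFreeLie deg Set.univ p := ∑ i ∈ Finset.range (k + 1), P i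
  have h1 : ∀ j < k + 1, lengthPart j (f - t).1 = 0 := by
    intro j hj
    have : (f - t).1 = f.1 - ∑ i ∈ Finset.range (k + 1), lengthPart i f.1 := by
      rw [Submodule.coe_sub, Submodule.coe_sum]
    rw [this, map_sub, map_sum, Finset.sum_eq_single j]
    · rw [lengthPart_lengthPart, if_pos rfl, sub_self]
    · intro i _ hij; rw [lengthPart_lengthPart, if_neg hij.symm]
    · intro h; exact absurd (Finset.mem_range.2 hj) h
  have h2 := lengthPart_d_eq_zero D (k + 1) p (f - t) h1 k (by omega)
  rw [map_sub, Submodule.coe_sub, map_sub, sub_eq_zero] at h2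
  rw [h2, map_sum, Submodule.coe_sum]
  exact (Submodule.sum_mem _ fun i _ => hpoly i (P i) (hf i)) k

/-- The restriction of `∂` to `𝕃̂(T)`, for a set `T` of generators with `∂T ⊆ 𝕃̂(T)`. -/
def restrictD [Fintype X] (D : CompleteFreeDGL deg Set.univ) (T : Set X)
    (hT : ∀ x ∈ T, (D.d (deg x) ⟨letter x, letter_mem (Set.mem_univ x) rfl⟩).1 ∈
      completeFreeLie deg T (deg x - 1)) (p : ℤ) :
    completeFreeLie deg T p →ₗ[ℚ] completeFreeLie deg T (p - 1) :=
  LinearMap.codRestrict _ ((completeFreeLie deg Set.univ (p - 1)).subtype ∘ₗ D.d p ∘ₗ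
      Submodule.inclusion (completeFreeLie_mono deg (Set.subset_univ T) p))
    (fun x => D.d_mem hT p _ x.2)

theorem restrictD_coe [Fintype X] (D : CompleteFreeDGL deg Set.univ) (T : Set X)
    (hT : ∀ x ∈ T, (D.d (deg x) ⟨letter x, letter_mem (Set.mem_univ x) rfl⟩).1 ∈
      completeFreeLie deg T (deg x - 1)) (p : ℤ) (x : completeFreeLie deg T p) :
    (D.restrictD T hT p x).1 =
      (D.d p ⟨x.1, completeFreeLie_mono deg (Set.subset_univ T) p x.2⟩).1 := rfl

/-- The complete sub DGL `(𝕃̂(T), ∂) ⊆ (𝕃̂(V), ∂)` for a set `T` of generators with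
`∂T ⊆ 𝕃̂(T)`. -/
def restrict [Fintype X] (D : CompleteFreeDGL deg Set.univ) (T : Set X)
    (hT : ∀ x ∈ T, (D.d (deg x) ⟨letter x, letter_mem (Set.mem_univ x) rfl⟩).1 ∈
      completeFreeLie deg T (deg x - 1)) : CompleteFreeDGL deg T where
  d := D.restrictD T hT
  leibniz p q x y := by
    rw [restrictD_coe, restrictD_coe, restrictD_coe]
    exact D.leibniz p q ⟨x.1, completeFreeLie_mono deg (Set.subset_univ T) p x.2⟩
      ⟨y.1, completeFreeLie_mono deg (Set.subset_univ T) q y.2⟩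
  d_d p x := by
    apply Subtype.ext
    rw [restrictD_coe]
    have h := D.d_d p ⟨x.1, completeFreeLie_mono deg (Set.subset_univ T) p x.2⟩
    exact (D.d_congr rfl _ (D.d p ⟨x.1, completeFreeLie_mono deg (Set.subset_univ T) p x.2⟩)
      (restrictD_coe D T hT p x)).trans (congrArg Subtype.val h)

end CompleteFreeDGL

/-! ### Compatible models of the standard simplices -/

/-- The simplices of `Δⁿ`: nonempty subsets of `{0, …, n}`. They index the generators
`a_{i₀…i_p}` of `𝕃̂(Δⁿ)`. -/
abbrev Face (n : ℕ) : Type := {σ : Finset (Fin (n + 1)) // σ.Nonempty}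

/-- The desuspended degree: a `p`-simplex, having `p + 1` vertices, is of degree `p - 1`. -/
def faceDegree {n : ℕ} (σ : Face n) : ℤ := (σ.1.card : ℤ) - 2

/-- The `0`-simplex `i`. -/
def vertexFace {n : ℕ} (i : Fin (n + 1)) : Face n := ⟨{i}, Finset.singleton_nonempty i⟩

theorem faceDegree_vertexFace {n : ℕ} (i : Fin (n + 1)) : faceDegree (vertexFace i) = -1 := by
  simp [faceDegree, vertexFace]

/-- The image of a simplex under the coface `δ_i : Δⁿ → Δⁿ⁺¹` that skips the vertex `i`. -/
def cofaceFace {n : ℕ} (i : Fin (n + 2)) : Face n ↪ Face (n + 1) where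
  toFun σ := ⟨σ.1.map i.succAboveEmb, σ.2.map⟩
  inj' σ τ h := Subtype.ext (Finset.map_injective _ (congrArg Subtype.val h))

theorem faceDegree_cofaceFace {n : ℕ} (i : Fin (n + 2)) (σ : Face n) :
    faceDegree (cofaceFace i σ) = faceDegree σ := by
  show ((σ.1.map i.succAboveEmb).card : ℤ) - 2 = _
  rw [Finset.card_map]; rfl

/-- `𝕃̂(Δⁿ)` in degree `p`. -/
abbrev simplexLie (n : ℕ) (p : ℤ) : Submodule ℚ (NCSeries (Face n)) :=
  completeFreeLie faceDegree Set.univ p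

/-- The generator of `𝕃̂(Δⁿ)` given by a simplex. -/
def simplexGen {n : ℕ} (σ : Face n) : simplexLie n (faceDegree σ) :=
  ⟨letter σ, letter_mem (Set.mem_univ σ) rfl⟩

/-- The generator `a_i` of `𝕃̂(Δⁿ)` given by a vertex. -/
def vertexGen {n : ℕ} (i : Fin (n + 1)) : simplexLie n (-1) :=
  ⟨letter (vertexFace i), letter_mem (Set.mem_univ _) (faceDegree_vertexFace i)⟩

/-- The morphism of complete graded Lie algebras `δ_i : 𝕃̂(Δⁿ) → 𝕃̂(Δⁿ⁺¹)` induced by the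
`i`-th coface on generators. -/
def coface {n : ℕ} (i : Fin (n + 2)) (p : ℤ) : simplexLie n p →ₗ[ℚ] simplexLie (n + 1) p :=
  LinearMap.codRestrict _ (rename (cofaceFace i) ∘ₗ (simplexLie n p).subtype)
    (fun x => rename_mem (cofaceFace i) (faceDegree_cofaceFace i)
      (fun _ _ => Set.mem_univ _) x.2)

/-- The coefficient of `τ` in the simplicial boundary `∑_j (-1)^j (i₀ … î_j … i_p)` of the
simplex `σ = (i₀ < … < i_p)`. -/
def boundaryCoeff {n : ℕ} (σ τ : Face n) : ℚ :=
  ∑ i ∈ σ.1, if τ.1 = σ.1.erase i then (-1 : ℚ) ^ (σ.1.filter (· < i)).card else 0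

/-- A sequence of compatible models of the standard simplices. -/
structure CompatibleModels where
  /-- the differential of `𝔏_n = (𝕃̂(Δⁿ), ∂)` -/
  model : ∀ n : ℕ, CompleteFreeDGL (X := Face n) faceDegree Set.univ
  /-- the vertices are Maurer-Cartan elements -/
  maurerCartan : ∀ (n : ℕ) (i : Fin (n + 1)), (model n).IsMaurerCartan (vertexGen i)
  /-- the linear part of `∂` is the simplicial boundary -/
  linearPart : ∀ (n : ℕ) (σ τ : Face n),
    ((model n).d (faceDegree σ) (simplexGen σ)).1 [τ] = boundaryCoeff σ τ
  /-- the coface maps commute with the differentials -/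
  coface_d : ∀ (n : ℕ) (i : Fin (n + 2)) (p : ℤ) (x : simplexLie n p),
    coface i (p - 1) ((model n).d p x) = (model (n + 1)).d p (coface i p x)

theorem CompatibleModels.d_gen_mem (M : CompatibleModels) {n : ℕ} (σ : Face n) :
    ((M.model n).d (faceDegree σ) (simplexGen σ)).1 ∈
      completeFreeLie faceDegree {τ : Face n | τ.1 ⊆ σ.1} (faceDegree σ - 1) := by
  induction n with
  | zero =>
    have : {τ : Face 0 | τ.1 ⊆ σ.1} = Set.univ := by
      ext τ
      obtain ⟨v, hv⟩ := σ.2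
      simp only [Set.mem_ofPred_eq, Set.mem_univ, iff_true]
      intro u _
      rwa [Subsingleton.elim (α := Fin 1) u v]
    rw [this]
    exact ((M.model 0).d _ _).2
  | succ n ih =>
    by_cases h : ∀ i, i ∈ σ.1
    · have : {τ : Face (n + 1) | τ.1 ⊆ σ.1} = Set.univ := by
        ext τ
        simp only [Set.mem_ofPred_eq, Set.mem_univ, iff_true]
        exact fun u _ => h u
      rw [this]
      exact ((M.model (n + 1)).d _ _).2
    · push Not at h
      obtain ⟨i, hi⟩ := h
      obtain ⟨σ', rfl⟩ : ∃ σ' : Face n, cofaceFace i σ' = σ := by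
        have hsub : ∀ u ∈ σ.1, ∃ v, i.succAbove v = u := fun u hu =>
          Fin.exists_succAbove_eq (fun h => hi (h ▸ hu))
        have hmap : (Finset.univ.filter (fun v => i.succAbove v ∈ σ.1)).map i.succAboveEmb
            = σ.1 := by
          ext u
          simp only [Finset.mem_map, Finset.mem_filter, Finset.mem_univ, true_and,
            Fin.succAboveEmb_apply]
          constructor
          · rintro ⟨v, hv, rfl⟩; exact hv
          · intro hu
            obtain ⟨v, rfl⟩ := hsub u hu
            exact ⟨v, hu, rfl⟩
        refine ⟨⟨Finset.univ.filter (fun v => i.succAbove v ∈ σ.1), ?_⟩, Subtype.ext hmap⟩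
        obtain ⟨u, hu⟩ := σ.2
        obtain ⟨v, rfl⟩ := hsub u hu
        exact ⟨v, by simpa using hu⟩
      have h1 := congrArg Subtype.val (M.coface_d n i (faceDegree σ') (simplexGen σ'))
      have h2 : ((M.model (n + 1)).d _ (coface i (faceDegree σ') (simplexGen σ'))).1 =
          ((M.model (n + 1)).d _ (simplexGen (cofaceFace i σ'))).1 :=
        (M.model (n + 1)).d_congr (faceDegree_cofaceFace i σ').symm _ _ (rename_letter _ _)
      rw [← h2, ← h1, faceDegree_cofaceFace]
      refine rename_mem (cofaceFace i) (faceDegree_cofaceFace i) ?_ (ih σ')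
      intro τ hτ
      exact Finset.map_subset_map.2 hτ

/-! ### The model of a finite simplicial complex -/

/-- The generators of `𝕃̂(Δⁿ)` given by the simplices of a subcomplex `K ⊆ Δⁿ`. -/
def complexGens {n : ℕ} (K : PreAbstractSimplicialComplex (Fin (n + 1))) : Set (Face n) :=
  {σ | σ.1 ∈ K.faces}

/-- The model `𝔏(K) = (𝕃̂(V), ∂)` of a finite simplicial complex `K ⊆ Δⁿ`: the complete sub DGL of
`𝔏_n` on the span `V` of the simplices of `K`. -/
def CompatibleModels.ofComplex (M : CompatibleModels) {n : ℕ}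
    (K : PreAbstractSimplicialComplex (Fin (n + 1))) :
    CompleteFreeDGL faceDegree (complexGens K) :=
  (M.model n).restrict (complexGens K) (fun σ hσ =>
    completeFreeLie_mono faceDegree
      (fun τ hτ => (K.isRelLowerSet_faces hσ).2 hτ τ.2) _ (M.d_gen_mem σ))

/-- The generator of `𝔏(K)` given by a vertex `a` of `K`. -/
def complexVertexGen {n : ℕ} (K : PreAbstractSimplicialComplex (Fin (n + 1))) (a : Fin (n + 1))
    (ha : {a} ∈ K.faces) : completeFreeLie faceDegree (complexGens K) (-1) :=
  ⟨letter (vertexFace a),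
    letter_mem (S := complexGens K) (x := vertexFace a) ha (faceDegree_vertexFace a)⟩

theorem CompatibleModels.isMaurerCartan_vertex (M : CompatibleModels) {n : ℕ}
    (K : PreAbstractSimplicialComplex (Fin (n + 1))) (a : Fin (n + 1)) (ha : {a} ∈ K.faces) :
    (M.ofComplex K).IsMaurerCartan (complexVertexGen K a ha) :=
  M.maurerCartan n a

/-- The DGL `(𝔏(K), ∂_a)` for a vertex `a` of `K`. -/
def CompatibleModels.ofComplexAt (M : CompatibleModels) {n : ℕ}
    (K : PreAbstractSimplicialComplex (Fin (n + 1))) (a : Fin (n + 1)) (ha : {a} ∈ K.faces) :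
    CompleteFreeDGL faceDegree (complexGens K) :=
  (M.ofComplex K).twist (complexVertexGen K a ha) (M.isMaurerCartan_vertex K a ha)

/-- The path component `K_a` of a vertex `a`: the simplices of `K` whose vertices are joined to
`a` by a path of edges of `K`. -/
def pathComponentComplex {n : ℕ} (K : PreAbstractSimplicialComplex (Fin (n + 1)))
    (a : Fin (n + 1)) : PreAbstractSimplicialComplex (Fin (n + 1)) where
  faces := {σ ∈ K.faces |
    ∀ v ∈ σ, Relation.ReflTransGen (fun u w => ({u, w} : Finset (Fin (n + 1))) ∈ K.faces) a v}
  isRelLowerSet_faces := by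
    rintro σ ⟨hσ, hp⟩
    refine ⟨(K.isRelLowerSet_faces hσ).1, fun τ hτ hne => ?_⟩
    exact ⟨(K.isRelLowerSet_faces hσ).2 hτ hne, fun v hv => hp v (hτ hv)⟩

theorem mem_pathComponentComplex {n : ℕ} (K : PreAbstractSimplicialComplex (Fin (n + 1)))
    (a : Fin (n + 1)) (ha : {a} ∈ K.faces) : {a} ∈ (pathComponentComplex K a).faces :=
  ⟨ha, fun v hv => by rw [Finset.mem_singleton.1 hv]⟩

/-- The inclusion of DGLs `(𝔏(K_a), ∂_a) → (𝔏(K), ∂_a)`. -/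
def CompatibleModels.componentInclusion (M : CompatibleModels) {n : ℕ}
    (K : PreAbstractSimplicialComplex (Fin (n + 1))) (a : Fin (n + 1)) (ha : {a} ∈ K.faces) :
    CompleteFreeDGL.Hom
      (M.ofComplexAt (pathComponentComplex K a) a (mem_pathComponentComplex K a ha))
      (M.ofComplexAt K a ha) :=
  CompleteFreeDGL.inclusion _ _ (fun _ hσ => hσ.1) (fun _ _ => rfl)

end

/-! Write `A` for the set of simplices of `K_a` and call the other letters outer. Let `F^k` consist
of the series all of whose words have at least `k` outer letters. The differential `∂_a` extends to
an odd derivation of the algebra of noncommutative power series. Before the twist, the boundary of a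
simplex involves only its faces, and a simplex of `K` with a face in `K_a` lies in `K_a`; so `∂`
preserves both the subalgebra on `A` and the one on the outer letters. Hence `∂_a` preserves every
`F^k`, and setting the outer letters to zero retracts `𝔏(K)` onto `𝔏(K_a)` with kernel the
subcomplex of Lie series in `F^1`. It remains to show that this kernel is acyclic.

Let `ε` be the sum of the coordinates at the vertices of `K_a`. It takes the value `1` on `a`, and
it vanishes on boundaries because the two ends of an edge have opposite signs. Let `K` (here an
operator, `derivation deg 0`) delete one letter of a word, with weight `ε` and the Koszul sign, but
never the last letter. Deletion with the last letter included is a derivation that annihilates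
commutators, so it sends `∂_a x` to `ε` of its linear part, which is zero. Therefore `K ∂_a + ∂_a K`
commutes with left multiplication by letters (`homotopy_letter_mul`) and is determined by its values
on letters. An outer `x` goes to `x`, because `∂_a x` contains `[a, x]` and `K` deletes `a`; a
letter of `A` goes to words in `A`. Thus `K ∂_a + ∂_a K` is the identity up to words that end in
`A`.

Since `K` does not preserve Lie series, it is followed by `r = rightNormed`, which sends `x₁ ⋯ xₙ`
to `[x₁, [x₂, …, xₙ]]` if `xₙ` is outer and to `0` otherwise. So `r (K ∂_a + ∂_a K) = r`
(`rightNormed_homotopy`). A variant of the Dynkin-Specht-Wever theorem gives `r l = N l` for Lie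
series `l`, where `N` counts outer letters (`rightNormed_of_mem`), and `r` commutes with `∂_a` up to
a gain of one in the filtration (`rightNormed_derivation_sub_mem`). For a Lie cycle `z` in `F^k`
with `k ≥ 1`, modulo `F^(k+1)`, `∂_a r K z ≡ r ∂_a K z = r z = N z ≡ k z`. So `z - ∂_a (k⁻¹ r K z)`
is a cycle in `F^(k+1)`. Iterating this gives a primitive of `z`; the corrections can be summed
because a word is at least as long as its number of outer letters (`exists_derivation_eq`). -/

noncomputable section

namespace NCSeries

variable {X : Type}

/-! ### Units, left shifts and supports of noncommutative power series -/

open scoped Classical in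
/-- The unit series, supported on the empty word. -/
def one : NCSeries X := fun w => if w = [] then 1 else 0

@[simp] theorem one_nil : (one : NCSeries X) [] = 1 := by simp [one]

@[simp] theorem one_cons (x : X) (w : List X) : (one : NCSeries X) (x :: w) = 0 := by simp [one]

/-- The series of the coefficients of the words `x :: w`. -/
def shift (x : X) : NCSeries X →ₗ[ℚ] NCSeries X where
  toFun f := fun w => f (x :: w)
  map_add' _ _ := rfl
  map_smul' _ _ := rfl

theorem shift_apply (x : X) (f : NCSeries X) (w : List X) : shift x f w = f (x :: w) := rfl

theorem mul_cons_shift (f g : NCSeries X) (x : X) (w : List X) :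
    (f * g) (x :: w) = f [] * g (x :: w) + (shift x f * g) w := mul_cons f g x w

theorem shift_mul (x : X) (f g : NCSeries X) :
    shift x (f * g) = f [] • shift x g + shift x f * g := by
  ext w; exact mul_cons f g x w

theorem one_mul' (f : NCSeries X) : one * f = f := by
  ext w
  cases w with
  | nil => simp [mul_nil]
  | cons x w =>
    have : shift x (one : NCSeries X) = 0 := by ext u; simp [shift_apply]
    rw [mul_cons_shift, this]; simp

theorem mul_one' (f : NCSeries X) : f * one = f := by
  ext w
  induction w generalizing f with
  | nil => simp [mul_nil]
  | cons x w ih => rw [mul_cons_shift, ih]; simp [shift_apply]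

theorem letter_nil (x : X) : letter x [] = 0 := by simp [letter]

theorem shift_letter_self (x : X) : shift x (letter x) = one := by
  ext w; simp [shift_apply, letter, one]

theorem shift_letter_of_ne {x y : X} (h : x ≠ y) : shift x (letter y) = 0 := by
  ext w; simp [shift_apply, letter, h]

theorem letter_mul_nil (x : X) (f : NCSeries X) : (letter x * f) [] = 0 := by
  simp [mul_nil, letter_nil]

theorem shift_letter_mul_self (x : X) (f : NCSeries X) : shift x (letter x * f) = f := by
  rw [shift_mul, letter_nil, zero_smul, zero_add, shift_letter_self, one_mul']

theorem shift_letter_mul_of_ne {x y : X} (h : x ≠ y) (f : NCSeries X) :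
    shift x (letter y * f) = 0 := by
  rw [shift_mul, letter_nil, zero_smul, zero_add, shift_letter_of_ne h, zero_mul]

theorem eq_sum_letter_mul_shift [Fintype X] (f : NCSeries X) (h : f [] = 0) :
    f = ∑ x, letter x * shift x f := by
  ext w
  rw [sum_apply]
  cases w with
  | nil => simp [h, letter_mul_nil]
  | cons y w =>
    rw [Finset.sum_eq_single y]
    · exact (congrFun (shift_letter_mul_self y (shift y f)) w).symm
    · intro x _ hx
      exact congrFun (shift_letter_mul_of_ne hx.symm (shift x f)) w
    · intro h; exact absurd (Finset.mem_univ y) h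

theorem sub_const_nil (f : NCSeries X) : (f - (f [] : ℚ) • one : NCSeries X) [] = 0 := by simp

/-- The series supported on the words satisfying `Q`. -/
def supp (Q : List X → Prop) : Submodule ℚ (NCSeries X) where
  carrier := {f | ∀ w, f w ≠ 0 → Q w}
  add_mem' {f g} hf hg w h := by
    by_cases h1 : f w = 0
    · exact hg w fun h2 => h (by simp [h1, h2])
    · exact hf w h1
  zero_mem' w h := absurd rfl h
  smul_mem' c f hf w h := hf w fun h1 => h (by simp [h1])

theorem supp_mono {Q R : List X → Prop} (h : ∀ w, Q w → R w) : supp Q ≤ supp R :=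
  fun _ hf w hw => h w (hf w hw)

theorem eq_zero_of_mem_supp {Q : List X → Prop} {f : NCSeries X} (hf : f ∈ supp Q) {w : List X}
    (hw : ¬ Q w) : f w = 0 := by
  by_contra h; exact hw (hf w h)

theorem exists_of_mul_ne_zero {f g : NCSeries X} {w : List X} (h : (f * g) w ≠ 0) :
    ∃ u v, w = u ++ v ∧ f u ≠ 0 ∧ g v ≠ 0 := by
  rw [mul_apply] at h
  obtain ⟨i, _, hi⟩ := Finset.exists_ne_zero_of_sum_ne_zero h
  exact ⟨_, _, (List.take_append_drop i w).symm, left_ne_zero_of_mul hi, right_ne_zero_of_mul hi⟩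

theorem mul_mem_supp {Q R T : List X → Prop} (h : ∀ u v, Q u → R v → T (u ++ v))
    {f g : NCSeries X} (hf : f ∈ supp Q) (hg : g ∈ supp R) : f * g ∈ supp T := by
  intro w hw
  obtain ⟨u, v, rfl, hu, hv⟩ := exists_of_mul_ne_zero hw
  exact h u v (hf u hu) (hg v hv)

theorem letter_mem_supp {Q : List X → Prop} {x : X} (h : Q [x]) : letter x ∈ supp Q := by
  intro w hw
  have : w = [x] := by by_contra h'; exact hw (by simp [letter, h'])
  rwa [this]

theorem bracket_mem_supp {Q R T : List X → Prop} (h : ∀ u v, Q u → R v → T (u ++ v))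
    (h' : ∀ u v, R u → Q v → T (u ++ v)) (p q : ℤ) {f g : NCSeries X} (hf : f ∈ supp Q)
    (hg : g ∈ supp R) : bracket p q f g ∈ supp T :=
  sub_mem (mul_mem_supp h hf hg) (Submodule.smul_mem _ _ (mul_mem_supp h' hg hf))

/-! ### Degrees of words and signs -/

theorem neg_one_zpow_eq {m n : ℤ} (h : ∃ k, m = n + 2 * k) : (-1 : ℚ) ^ m = (-1) ^ n := by
  obtain ⟨k, rfl⟩ := h
  rw [zpow_add₀ (by norm_num), zpow_mul]; simp

/-- The degree of a word. -/
def wordDegree (deg : X → ℤ) (w : List X) : ℤ := (w.map deg).sum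

variable (deg : X → ℤ)

@[simp] theorem wordDegree_nil : wordDegree deg [] = 0 := rfl

@[simp] theorem wordDegree_cons (x : X) (w : List X) :
    wordDegree deg (x :: w) = deg x + wordDegree deg w := rfl

@[simp] theorem wordDegree_append (u v : List X) :
    wordDegree deg (u ++ v) = wordDegree deg u + wordDegree deg v := by
  simp [wordDegree]

/-- The homogeneous series of degree `p`. -/
abbrev homogeneous (p : ℤ) : Submodule ℚ (NCSeries X) := supp fun w => wordDegree deg w = p

/-- The automorphism that multiplies series of degree `q` by `(-1)^{p q}`. -/
def signTwist (p : ℤ) : NCSeries X →ₗ[ℚ] NCSeries X where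
  toFun f := fun w => (-1 : ℚ) ^ (p * wordDegree deg w) * f w
  map_add' f g := by ext w; exact mul_add _ _ _
  map_smul' c f := by ext w; exact mul_left_comm _ _ _

theorem signTwist_apply (p : ℤ) (f : NCSeries X) (w : List X) :
    signTwist deg p f w = (-1 : ℚ) ^ (p * wordDegree deg w) * f w := rfl

theorem signTwist_congr {p q : ℤ} (h : ∃ k, p = q + 2 * k) :
    signTwist (X := X) deg p = signTwist deg q := by
  ext f w
  obtain ⟨k, rfl⟩ := h
  rw [signTwist_apply, signTwist_apply,
    neg_one_zpow_eq (n := q * wordDegree deg w) ⟨k * wordDegree deg w, by ring⟩]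

theorem shift_signTwist (p : ℤ) (x : X) (f : NCSeries X) :
    shift x (signTwist deg p f) = (-1 : ℚ) ^ (p * deg x) • signTwist deg p (shift x f) := by
  ext w
  rw [shift_apply, signTwist_apply, smul_apply, signTwist_apply, shift_apply, wordDegree_cons,
    mul_add, zpow_add₀ (by norm_num), mul_assoc]

theorem signTwist_mul (p : ℤ) (f g : NCSeries X) :
    signTwist deg p (f * g) = signTwist deg p f * signTwist deg p g := by
  ext w
  rw [signTwist_apply, mul_apply, mul_apply, Finset.mul_sum]
  refine Finset.sum_congr rfl fun i _ => ?_
  conv_lhs => rw [← List.take_append_drop i w, wordDegree_append, mul_add, zpow_add₀ (by norm_num)]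
  rw [signTwist_apply, signTwist_apply]
  simp only [List.take_append_drop]
  ring

theorem signTwist_signTwist (p q : ℤ) (f : NCSeries X) :
    signTwist deg p (signTwist deg q f) = signTwist deg (p + q) f := by
  ext w
  rw [signTwist_apply, signTwist_apply, signTwist_apply, add_mul, zpow_add₀ (by norm_num), mul_assoc]

theorem signTwist_of_homogeneous (p : ℤ) {q : ℤ} {f : NCSeries X} (hf : f ∈ homogeneous deg q) :
    signTwist deg p f = (-1 : ℚ) ^ (p * q) • f := by
  ext w
  rw [signTwist_apply, smul_apply]
  by_cases h : f w = 0
  · simp [h]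
  · rw [hf w h]

theorem letter_homogeneous (x : X) : letter x ∈ homogeneous deg (deg x) :=
  letter_mem_supp (by simp)

theorem signTwist_mem_supp {Q : List X → Prop} (p : ℤ) {f : NCSeries X} (hf : f ∈ supp Q) :
    signTwist deg p f ∈ supp Q :=
  fun w hw => hf w (right_ne_zero_of_mul hw)

/-- The commutator `[f, g]` of a series `f` of degree `p` with an arbitrary series `g`. -/
def commutator (p : ℤ) : NCSeries X →ₗ[ℚ] NCSeries X →ₗ[ℚ] NCSeries X :=
  LinearMap.mk₂ ℚ (fun f g => f * g - signTwist deg p g * f)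
    (fun f f' g => by simp only [add_mul, mul_add]; abel)
    (fun c f g => by simp only [smul_mul_assoc, mul_smul_comm, smul_sub])
    (fun f g g' => by simp only [map_add, add_mul, mul_add]; abel)
    (fun c f g => by simp only [map_smul, smul_mul_assoc, mul_smul_comm, smul_sub])

theorem commutator_apply (p : ℤ) (f g : NCSeries X) :
    commutator deg p f g = f * g - signTwist deg p g * f := rfl

theorem commutator_of_homogeneous {p q : ℤ} (f : NCSeries X) {g : NCSeries X}
    (hg : g ∈ homogeneous deg q) : commutator deg p f g = bracket p q f g := by
  rw [commutator_apply, signTwist_of_homogeneous deg p hg, bracket, smul_mul_assoc]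

/-- The Jacobi identity in the form `ad_{[f,g]} = [ad_f, ad_g]`. The last argument need not be
homogeneous, since `signTwist` supplies its sign word by word. -/
theorem commutator_bracket {p q : ℤ} {f g : NCSeries X} (hf : f ∈ homogeneous deg p)
    (hg : g ∈ homogeneous deg q) (h : NCSeries X) :
    commutator deg (p + q) (bracket p q f g) h =
      commutator deg p f (commutator deg q g h) -
        (-1 : ℚ) ^ (p * q) • commutator deg q g (commutator deg p f h) := by
  simp only [commutator_apply]
  simp only [map_sub, signTwist_mul, signTwist_of_homogeneous deg _ hf,
    signTwist_of_homogeneous deg _ hg, signTwist_signTwist, bracket, add_comm q p, mul_comm q p]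
  simp only [mul_sub, sub_mul, mul_smul_comm, smul_mul_assoc, smul_sub, smul_smul, mul_assoc,
    neg_one_zpow_mul_self, one_smul]
  abel

theorem commutator_mem_supp {Q R T : List X → Prop} (h : ∀ u v, Q u → R v → T (u ++ v))
    (h' : ∀ u v, R u → Q v → T (u ++ v)) (p : ℤ) {f g : NCSeries X} (hf : f ∈ supp Q)
    (hg : g ∈ supp R) : commutator deg p f g ∈ supp T :=
  sub_mem (mul_mem_supp h hf hg) (mul_mem_supp h' (signTwist_mem_supp deg p hg) hf)

/-- Bracketing with a letter raises word length by one, so coefficients up to length `n + 1` depend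
only on those up to length `n`. The recursion for `rightNormed` and the inductions on length rest on
this. -/
theorem commutator_letter_congr (p : ℤ) (x : X) {f g : NCSeries X} {n : ℕ}
    (h : ∀ w : List X, w.length ≤ n → f w = g w) {w : List X} (hw : w.length ≤ n + 1) :
    commutator deg p (letter x) f w = commutator deg p (letter x) g w := by
  rw [← sub_eq_zero, ← sub_apply, ← map_sub]
  have h1 : f - g ∈ supp fun w => n + 1 ≤ w.length := by
    intro u hu
    by_contra hlt
    exact hu (by rw [sub_apply, h u (by omega), sub_self])
  have h2 : letter x ∈ supp fun w : List X => 1 ≤ w.length := letter_mem_supp (by simp)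
  have h3 := commutator_mem_supp deg (T := fun w => n + 2 ≤ w.length)
    (fun u v hu hv => by simp; omega) (fun u v hu hv => by simp; omega) p h2 h1
  by_contra h4
  have := h3 w h4
  omega

theorem lengthPart_commutator_letter (n : ℕ) (p : ℤ) (x : X) (g : NCSeries X) :
    lengthPart (n + 1) (commutator deg p (letter x) g) =
      commutator deg p (letter x) (lengthPart n g) := by
  ext w
  rw [lengthPart_apply]
  have hL : letter x ∈ supp fun v : List X => v.length = 1 := letter_mem_supp rfl
  split_ifs with h
  · rw [← sub_eq_zero, ← sub_apply, ← map_sub]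
    by_contra h1
    have := commutator_mem_supp deg (R := fun w => w.length ≠ n) (T := fun w => w.length ≠ n + 1)
      (fun u v hu hv => by simp; omega) (fun u v hu hv => by simp; omega) p hL
      (g := g - lengthPart n g)
      (fun u hu hl => hu (by rw [sub_apply, lengthPart_apply, if_pos hl, sub_self])) w h1
    exact this h
  · by_contra h1
    have := commutator_mem_supp deg (R := fun w => w.length = n) (T := fun w => w.length = n + 1)
      (fun u v hu hv => by simp; omega) (fun u v hu hv => by simp; omega) p hL
      (g := lengthPart n g)
      (fun u hu => by by_contra hl; exact hu (by rw [lengthPart_apply, if_neg hl])) w (Ne.symm h1)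
    exact h this

/-! ### The number of letters outside of a set -/

variable (A : Set X)

open scoped Classical in
/-- The number of letters of a word outside of `A`. -/
def outerCount (w : List X) : ℕ := (w.map fun x => if x ∈ A then 0 else 1).sum

@[simp] theorem outerCount_nil : outerCount A [] = 0 := rfl

open scoped Classical in
@[simp] theorem outerCount_cons (x : X) (w : List X) :
    outerCount A (x :: w) = (if x ∈ A then 0 else 1) + outerCount A w := by
  simp [outerCount]

@[simp] theorem outerCount_append (u v : List X) :
    outerCount A (u ++ v) = outerCount A u + outerCount A v := by simp [outerCount]

theorem outerCount_perm {u v : List X} (h : u.Perm v) : outerCount A u = outerCount A v :=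
  (h.map _).sum_eq

theorem outerCount_le_length (w : List X) : outerCount A w ≤ w.length := by
  induction w with
  | nil => simp
  | cons x w ih => rw [outerCount_cons, List.length_cons]; split_ifs <;> omega

theorem outerCount_eq_length {w : List X} (h : ∀ x ∈ w, x ∉ A) : outerCount A w = w.length := by
  induction w with
  | nil => simp
  | cons x w ih =>
    rw [outerCount_cons, List.length_cons, if_neg (h x (by simp)), ih fun y hy => h y (by simp [hy]),
      add_comm]

theorem outerCount_eq_zero_iff {w : List X} : outerCount A w = 0 ↔ ∀ x ∈ w, x ∈ A := by
  induction w with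
  | nil => simp
  | cons x w ih => simp [ih]

/-- The series whose words contain at least `k` letters outside of `A`. -/
abbrev outerFiltration (k : ℕ) : Submodule ℚ (NCSeries X) := supp fun w => k ≤ outerCount A w

/-- The derivation that multiplies every word by the number of its letters outside of `A`. -/
def countOuter : NCSeries X →ₗ[ℚ] NCSeries X where
  toFun f := fun w => outerCount A w * f w
  map_add' f g := by ext w; exact mul_add _ _ _
  map_smul' c f := by ext w; exact mul_left_comm _ _ _

theorem countOuter_apply (f : NCSeries X) (w : List X) :
    countOuter A f w = outerCount A w * f w := rfl

theorem countOuter_mul (f g : NCSeries X) :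
    countOuter A (f * g) = countOuter A f * g + f * countOuter A g := by
  ext w
  rw [countOuter_apply, add_apply, mul_apply, mul_apply, mul_apply, Finset.mul_sum,
    ← Finset.sum_add_distrib]
  refine Finset.sum_congr rfl fun i _ => ?_
  conv_lhs => rw [← List.take_append_drop i w, outerCount_append]
  simp only [List.take_append_drop, countOuter_apply]
  push_cast
  ring

theorem countOuter_mem_supp {Q : List X → Prop} {f : NCSeries X} (hf : f ∈ supp Q) :
    countOuter A f ∈ supp Q :=
  fun w hw => hf w (right_ne_zero_of_mul hw)

theorem countOuter_letter (x : X) (hx : x ∉ A) : countOuter A (letter x) = letter x := by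
  ext w
  rw [countOuter_apply]
  by_cases h : w = [x]
  · simp [h, hx]
  · simp [letter, h]

theorem countOuter_eq_zero {f : NCSeries X} (hf : f ∈ supp fun w => ∀ x ∈ w, x ∈ A) :
    countOuter A f = 0 := by
  ext w
  rw [countOuter_apply]
  by_cases h : f w = 0
  · simp [h]
  · simp [(outerCount_eq_zero_iff A).2 (hf w h)]

/-- The multiples `k f - N f`, with `N` the number of outer letters, kill the lowest part. -/
theorem smul_sub_countOuter_mem {k : ℕ} {f : NCSeries X} (hf : f ∈ outerFiltration A k) :
    (k : ℚ) • f - countOuter A f ∈ outerFiltration A (k + 1) := by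
  intro w hw
  have h1 : f w ≠ 0 := fun h => hw (by simp [countOuter_apply, h])
  rcases (hf w h1).lt_or_eq with h | h
  · exact h
  · exact absurd (by simp [countOuter_apply, ← h]) hw

end NCSeries

namespace NCSeries

variable {X : Type} [Fintype X] (deg : X → ℤ)

/-! ### Odd derivations -/

/-- The coefficient of `w` in `derivation deg c φ f`. -/
def derivationCoeff (c : ℚ) (φ : X → NCSeries X) : List X → NCSeries X →ₗ[ℚ] ℚ
  | [] =>
    { toFun := fun f => c * ∑ x, φ x [] * f [x]
      map_add' := fun f g => by simp [mul_add, Finset.sum_add_distrib]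
      map_smul' := fun b f => by
        simp only [smul_apply, Finset.mul_sum, RingHom.id_apply, smul_eq_mul]
        exact Finset.sum_congr rfl fun x _ => by ring }
  | y :: w =>
    { toFun := fun f => ∑ x, (φ x * shift x f) (y :: w) +
        (-1 : ℚ) ^ deg y * derivationCoeff c φ w (shift y f)
      map_add' := fun f g => by
        simp only [map_add, mul_add, add_apply, Finset.sum_add_distrib]; ring
      map_smul' := fun b f => by
        simp only [map_smul, mul_smul_comm, smul_apply, ← Finset.mul_sum, RingHom.id_apply,
          smul_eq_mul]
        ring }

/-- The odd derivation `f₁ ⋯ fₙ ↦ ∑ᵢ ± f₁ ⋯ φ(fᵢ) ⋯ fₙ` of the algebra of noncommutative power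
series with values `φ x` on the letters, for `c = 1`. For `c = 0` the constant terms of the
`φ x` for the last letters `x` of words are neglected; this matters only if there are any. -/
def derivation (c : ℚ) (φ : X → NCSeries X) : NCSeries X →ₗ[ℚ] NCSeries X where
  toFun f := fun w => derivationCoeff deg c φ w f
  map_add' f g := by ext w; exact map_add (derivationCoeff deg c φ w) f g
  map_smul' b f := by ext w; exact map_smul (derivationCoeff deg c φ w) b f

variable (c : ℚ) (φ : X → NCSeries X)

theorem derivation_nil (f : NCSeries X) :
    derivation deg c φ f [] = c * ∑ x, φ x [] * f [x] := rfl

theorem derivation_cons (f : NCSeries X) (y : X) (w : List X) :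
    derivation deg c φ f (y :: w) = ∑ x, (φ x * shift x f) (y :: w) +
      (-1 : ℚ) ^ deg y * derivation deg c φ (shift y f) w := rfl

theorem shift_derivation (f : NCSeries X) (y : X) :
    shift y (derivation deg c φ f) = ∑ x, shift y (φ x * shift x f) +
      (-1 : ℚ) ^ deg y • derivation deg c φ (shift y f) := by
  ext w
  rw [add_apply, sum_apply]
  exact derivation_cons deg c φ f y w

/-- If `f` has no constant term, the last letter of every word of `g * f` comes from `f`. Hence `g`
meets the full derivation (`1`), and the exceptional treatment of last letters (`c`) concerns `f`
alone. -/
theorem derivation_mul {f : NCSeries X} (h : c = 1 ∨ f [] = 0) (g : NCSeries X) :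
    derivation deg c φ (g * f) =
      derivation deg 1 φ g * f + signTwist deg 1 g * derivation deg c φ f := by
  ext w
  induction w generalizing g with
  | nil =>
    simp only [derivation_nil, add_apply, mul_nil, mul_cons_shift, signTwist_apply, wordDegree_nil]
    -- This is the only place where the alternative `c = 1 ∨ f [] = 0` enters.
    have h1 : c * f [] = f [] := by rcases h with h | h <;> simp [h]
    simp only [mul_add, Finset.sum_add_distrib]
    rw [show ∑ x, φ x [] * (shift x g [] * f []) = (∑ x, φ x [] * g [x]) * f [] by
      rw [Finset.sum_mul]
      exact Finset.sum_congr rfl fun x _ => by rw [shift_apply]; ring]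
    rw [show ∑ x, φ x [] * (g [] * f [x]) = g [] * ∑ x, φ x [] * f [x] by
      rw [Finset.mul_sum]
      exact Finset.sum_congr rfl fun x _ => by ring]
    simp only [mul_zero, zpow_zero]
    linear_combination (∑ x, φ x [] * g [x]) * h1
  | cons y w ih =>
    have e1 : ∀ x, (φ x * shift x (g * f)) (y :: w) =
        g [] * (φ x * shift x f) (y :: w) + φ x [] * g [x] * f (y :: w) +
          (shift y (φ x * shift x g) * f) w := by
      intro x
      rw [shift_mul, mul_add, mul_smul_comm, ← mul_assoc, add_apply, smul_apply,
        mul_cons_shift (φ x * shift x g), mul_nil, shift_apply]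
      ring
    rw [derivation_cons, shift_mul, map_add, map_smul, add_apply, smul_apply, ih, add_apply,
      add_apply, mul_cons_shift (derivation deg 1 φ g), mul_cons_shift (signTwist deg 1 g),
      derivation_nil, derivation_cons, shift_derivation, shift_signTwist, add_mul, add_apply,
      Finset.sum_mul, sum_apply, smul_mul_assoc, smul_mul_assoc, smul_apply, smul_apply,
      signTwist_apply, wordDegree_nil]
    simp only [e1, Finset.sum_add_distrib, ← Finset.mul_sum, ← Finset.sum_mul, mul_zero, zpow_zero,
      one_mul]
    ring

theorem derivation_one : derivation deg c φ one = 0 := by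
  have hs : ∀ z : X, shift z one = 0 := fun z => by ext u; simp [shift_apply]
  ext u
  cases u with
  | nil => simp [derivation_nil]
  | cons z u => rw [derivation_cons]; simp [hs]

theorem derivation_letter (x : X) : derivation deg 1 φ (letter x) = φ x := by
  ext w
  cases w with
  | nil =>
    rw [derivation_nil, Finset.sum_eq_single x]
    · simp [letter]
    · intro y _ hy; simp [letter, hy]
    · intro h; exact absurd (Finset.mem_univ x) h
  | cons y w =>
    have h0 : derivation deg 1 φ (shift y (letter x)) w = 0 := by
      by_cases hy : y = x
      · subst hy
        rw [shift_letter_self]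
        rw [derivation_one]; rfl
      · rw [shift_letter_of_ne hy, map_zero]; rfl
    rw [derivation_cons, h0, Finset.sum_eq_single x]
    · rw [shift_letter_self, mul_one', mul_zero, add_zero]
    · intro z _ hz; rw [shift_letter_of_ne hz, mul_zero]; rfl
    · intro h; exact absurd (Finset.mem_univ x) h

/-- Each term of the derivation replaces one letter `x` of a word of `f` by a word `s` of `φ x`. All
estimates of degree, length and number of outer letters are read off from this. -/
theorem exists_of_derivation_ne_zero {f : NCSeries X} {w : List X}
    (h : derivation deg c φ f w ≠ 0) :
    ∃ u x s t, w = u ++ (s ++ t) ∧ φ x s ≠ 0 ∧ f (u ++ x :: t) ≠ 0 := by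
  induction w generalizing f with
  | nil =>
    rw [derivation_nil] at h
    obtain ⟨x, _, hx⟩ := Finset.exists_ne_zero_of_sum_ne_zero (right_ne_zero_of_mul h)
    exact ⟨[], x, [], [], rfl, left_ne_zero_of_mul hx, right_ne_zero_of_mul hx⟩
  | cons y w ih =>
    rw [derivation_cons] at h
    by_cases h1 : ∑ x, (φ x * shift x f) (y :: w) = 0
    · rw [h1, zero_add] at h
      obtain ⟨u, x, s, t, rfl, hs, hf⟩ := ih (right_ne_zero_of_mul h)
      exact ⟨y :: u, x, s, t, rfl, hs, hf⟩
    · obtain ⟨x, _, hx⟩ := Finset.exists_ne_zero_of_sum_ne_zero h1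
      obtain ⟨s, t, hw, hs, hf⟩ := exists_of_mul_ne_zero hx
      exact ⟨[], x, s, t, hw, hs, hf⟩

theorem derivation_mem_supp {Q R : List X → Prop}
    (h : ∀ u x s t, φ x s ≠ 0 → Q (u ++ x :: t) → R (u ++ (s ++ t))) {f : NCSeries X}
    (hf : f ∈ supp Q) : derivation deg c φ f ∈ supp R := by
  intro w hw
  obtain ⟨u, x, s, t, rfl, hs, hf'⟩ := exists_of_derivation_ne_zero deg c φ hw
  exact h u x s t hs (hf _ hf')

theorem derivation_signTwist {e : ℤ} (hφ : ∀ x, φ x ∈ homogeneous deg (deg x + e)) (p : ℤ)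
    (f : NCSeries X) :
    derivation deg c φ (signTwist deg p f) =
      (-1 : ℚ) ^ (p * e) • signTwist deg p (derivation deg c φ f) := by
  have hs : ∀ (x : X) (w : List X), φ x w ≠ 0 → wordDegree deg w = deg x + e := fun x w h => hφ x w h
  ext w
  induction w generalizing f with
  | nil =>
    rw [smul_apply, signTwist_apply, derivation_nil, derivation_nil, wordDegree_nil, mul_zero,
      zpow_zero, one_mul, Finset.mul_sum, Finset.mul_sum, Finset.mul_sum]
    refine Finset.sum_congr rfl fun x _ => ?_
    rw [signTwist_apply]
    by_cases h : φ x [] = 0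
    · simp [h]
    · have := hs x [] h
      rw [wordDegree_nil] at this
      -- A nonzero constant term of `φ x` forces `deg x + e = 0`.
      have e1 : wordDegree deg [x] = -e := by simp; omega
      rw [e1, neg_one_zpow_eq (m := p * -e) (n := p * e) ⟨-(p * e), by ring⟩]
      ring
  | cons y w ih =>
    rw [smul_apply, signTwist_apply, derivation_cons, derivation_cons, shift_signTwist, map_smul,
      smul_apply, ih, smul_apply, signTwist_apply, mul_add, mul_add, Finset.mul_sum,
      Finset.mul_sum]
    congr 1
    · refine Finset.sum_congr rfl fun x _ => ?_
      rw [shift_signTwist, mul_smul_comm, ← mul_assoc]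
      have h1 : φ x = (-1 : ℚ) ^ (p * (deg x + e)) • signTwist deg p (φ x) := by
        rw [signTwist_of_homogeneous deg p (hφ x), smul_smul, neg_one_zpow_mul_self, one_smul]
      conv_lhs => rw [h1]
      rw [smul_mul_assoc, smul_smul, ← signTwist_mul, smul_apply, signTwist_apply, mul_add,
        zpow_add₀ (by norm_num), ← mul_assoc, ← mul_assoc, neg_one_zpow_mul_self]
      ring
    · rw [wordDegree_cons, mul_add, zpow_add₀ (by norm_num)]
      ring

/-- An odd derivation is a derivation for the commutator with an element of degree `p`. -/
theorem derivation_commutator (hφ : ∀ x, φ x ∈ homogeneous deg (deg x - 1)) {p : ℤ}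
    {f : NCSeries X} (hf : f ∈ homogeneous deg p) (g : NCSeries X) :
    derivation deg 1 φ (commutator deg p f g) =
      commutator deg (p - 1) (derivation deg 1 φ f) g +
        (-1 : ℚ) ^ p • commutator deg p f (derivation deg 1 φ g) := by
  rw [commutator_apply, map_sub, derivation_mul deg 1 φ (.inl rfl), derivation_mul deg 1 φ (.inl rfl),
    derivation_signTwist deg 1 φ (e := -1) hφ, signTwist_signTwist, signTwist_of_homogeneous deg 1 hf,
    commutator_apply, commutator_apply, signTwist_congr deg (p := p - 1) (q := 1 + p) ⟨-1, by ring⟩,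
    neg_one_zpow_eq (m := p * -1) (n := p) ⟨-p, by ring⟩, one_mul]
  simp only [smul_mul_assoc, smul_sub]
  abel

/-! ### Right-normed bracketing -/

variable (A : Set X)

open scoped Classical in
/-- Approximations of `rightNormed`, correct for words of length at most `n`. -/
def rightNormedAux : ℕ → NCSeries X →ₗ[ℚ] NCSeries X
  | 0 => 0
  | n + 1 =>
    { toFun := fun f => ∑ x, (if x ∈ A then 0 else f [x] • letter x) +
        ∑ x, commutator deg (deg x) (letter x) (rightNormedAux n (shift x f))
      map_add' := fun f g => by
        simp only [map_add, add_apply, add_smul, Finset.sum_add_distrib]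
        rw [add_add_add_comm, ← Finset.sum_add_distrib (f := fun x => ite _ _ _)]
        congr 2
        funext x
        split_ifs <;> simp
      map_smul' := fun b f => by
        simp only [map_smul, smul_apply, smul_add, Finset.smul_sum, RingHom.id_apply, mul_smul]
        congr 1
        exact Finset.sum_congr rfl fun x _ => by split_ifs <;> simp }

open scoped Classical in
theorem rightNormedAux_succ (n : ℕ) (f : NCSeries X) :
    rightNormedAux deg A (n + 1) f = ∑ x, (if x ∈ A then 0 else f [x] • letter x) +
        ∑ x, commutator deg (deg x) (letter x) (rightNormedAux deg A n (shift x f)) := rfl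

/-- Each further step of the recursion changes only longer words, so the approximations converge
coefficientwise. Starting from `0` is right because brackets have no constant term. -/
theorem rightNormedAux_stable (n : ℕ) (f : NCSeries X) (w : List X) (hw : w.length ≤ n) :
    rightNormedAux deg A (n + 1) f w = rightNormedAux deg A n f w := by
  induction n generalizing f w with
  | zero =>
    obtain rfl : w = [] := List.length_eq_zero_iff.1 (by omega)
    rw [rightNormedAux_succ, add_apply, sum_apply, sum_apply, Finset.sum_eq_zero,
      Finset.sum_eq_zero]
    · exact add_zero 0
    · intro x _; simp [rightNormedAux]
    · intro x _; split_ifs <;> simp [letter_nil]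
  | succ n ih =>
    rw [rightNormedAux_succ, rightNormedAux_succ deg A n, add_apply, add_apply, sum_apply, sum_apply,
      sum_apply]
    congr 1
    exact Finset.sum_congr rfl fun x _ =>
      commutator_letter_congr deg _ x (fun u hu => ih (shift x f) u hu) hw

theorem rightNormedAux_eq {n : ℕ} (f : NCSeries X) (w : List X) (hw : w.length ≤ n) :
    rightNormedAux deg A n f w = rightNormedAux deg A w.length f w := by
  induction n, hw using Nat.le_induction with
  | base => rfl
  | succ n hn ih => rw [rightNormedAux_stable deg A n f w hn, ih]

/-- Right-normed bracketing of words that do not end in a letter of `A`: the word `x₁ ⋯ xₙ` is sent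
to `[x₁, [x₂, ⋯, xₙ]]` if `xₙ ∉ A`, and to `0` otherwise. -/
def rightNormed : NCSeries X →ₗ[ℚ] NCSeries X where
  toFun f := fun w => rightNormedAux deg A w.length f w
  map_add' f g := by ext w; rw [map_add]; rfl
  map_smul' b f := by ext w; rw [map_smul]; rfl

theorem rightNormed_apply (f : NCSeries X) (w : List X) :
    rightNormed deg A f w = rightNormedAux deg A w.length f w := rfl

open scoped Classical in
theorem rightNormed_eq (f : NCSeries X) :
    rightNormed deg A f = ∑ x, (if x ∈ A then 0 else f [x] • letter x) +
        ∑ x, commutator deg (deg x) (letter x) (rightNormed deg A (shift x f)) := by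
  ext w
  rw [rightNormed_apply, ← rightNormedAux_eq deg A (n := w.length + 1) f w (by omega),
    rightNormedAux_succ, add_apply, add_apply, sum_apply, sum_apply, sum_apply]
  congr 1
  refine Finset.sum_congr rfl fun x _ => commutator_letter_congr deg _ x (n := w.length) ?_ (by omega)
  intro u hu
  rw [rightNormed_apply, rightNormedAux_eq deg A (shift x f) u hu]

theorem rightNormed_letter_mul (x : X) {f : NCSeries X} (hf : f [] = 0) :
    rightNormed deg A (letter x * f) = commutator deg (deg x) (letter x) (rightNormed deg A f) := by
  rw [rightNormed_eq, Finset.sum_eq_zero, zero_add, Finset.sum_eq_single x, shift_letter_mul_self]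
  · intro y _ hy; rw [shift_letter_mul_of_ne hy, map_zero, map_zero]
  · intro h; exact absurd (Finset.mem_univ x) h
  · intro y _
    have : (letter x * f) [y] = 0 := by
      rw [mul_cons_shift, letter_nil, zero_mul, mul_nil, hf, mul_zero, add_zero]
    rw [this, zero_smul, ite_self]

theorem rightNormed_nil (f : NCSeries X) : rightNormed deg A f [] = 0 := rfl

theorem rightNormed_one : rightNormed deg A one = 0 := by
  rw [rightNormed_eq, Finset.sum_eq_zero, zero_add, Finset.sum_eq_zero]
  · intro x _
    have : shift x (one : NCSeries X) = 0 := by ext u; simp [shift_apply]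
    rw [this, map_zero, map_zero]
  · intro x _; simp

theorem rightNormed_letter (x : X) (hx : x ∉ A) : rightNormed deg A (letter x) = letter x := by
  rw [rightNormed_eq, Finset.sum_eq_single x, if_neg hx, Finset.sum_eq_zero]
  · simp [letter]
  · intro y _
    by_cases hy : y = x
    · rw [hy, shift_letter_self, rightNormed_one, map_zero]
    · rw [shift_letter_of_ne hy, map_zero, map_zero]
  · intro y _ hy; simp [letter, hy]
  · intro h; exact absurd (Finset.mem_univ x) h

/-- An iterated bracket of letters is a combination of rearrangements of its word. Hence
`rightNormed` preserves every support condition invariant under permutations: degree, length,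
letters used, number of outer letters. -/
theorem exists_of_rightNormed_ne_zero {f : NCSeries X} {w : List X}
    (h : rightNormed deg A f w ≠ 0) :
    ∃ u x, x ∉ A ∧ (u ++ [x]).Perm w ∧ f (u ++ [x]) ≠ 0 := by
  induction hn : w.length generalizing f w with
  | zero =>
    obtain rfl : w = [] := List.length_eq_zero_iff.1 hn
    exact absurd (rightNormed_nil deg A f) h
  | succ n ih =>
    rw [rightNormed_eq, add_apply, sum_apply, sum_apply] at h
    by_cases h1 : ∑ x, (if x ∈ A then 0 else f [x] • letter x : NCSeries X) w = 0
    · rw [h1, zero_add] at h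
      obtain ⟨x, _, hx⟩ := Finset.exists_ne_zero_of_sum_ne_zero h
      -- The induction hypothesis speaks only of words of length `n`, so the support condition is
      -- made vacuous for all others.
      let Q : List X → Prop := fun w => w.length = n → ∃ u y, y ∉ A ∧ (u ++ [y]).Perm w ∧
        f (x :: (u ++ [y])) ≠ 0
      have hQ : rightNormed deg A (shift x f) ∈ supp Q := fun v hv hvn => ih hv hvn
      have hL : letter x ∈ supp fun v => v = [x] := letter_mem_supp rfl
      have hT := commutator_mem_supp deg (T := fun w => w.length = n + 1 →
        ∃ u y, y ∉ A ∧ (u ++ [y]).Perm w ∧ f (u ++ [y]) ≠ 0) (R := Q) ?_ ?_ (deg x) hL hQ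
      · exact hT w hx hn
      · rintro u v rfl hv hl
        obtain ⟨u, y, hy, hp, hf⟩ := hv (by simpa using hl)
        exact ⟨x :: u, y, hy, hp.cons x, hf⟩
      · rintro v u hv rfl hl
        obtain ⟨u, y, hy, hp, hf⟩ := hv (by simpa using hl)
        exact ⟨x :: u, y, hy, (hp.cons x).trans (List.perm_append_singleton x v).symm, hf⟩
    · obtain ⟨x, _, hx⟩ := Finset.exists_ne_zero_of_sum_ne_zero h1
      split_ifs at hx with hA
      · exact absurd rfl hx
      · rw [smul_apply] at hx
        have hw : w = [x] := letter_mem_supp (Q := fun v => v = [x]) rfl w (right_ne_zero_of_mul hx)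
        exact ⟨[], x, hA, by rw [hw]; rfl, left_ne_zero_of_mul hx⟩

theorem rightNormed_mem_supp {Q : List X → Prop} (h : ∀ u v : List X, u.Perm v → Q u → Q v)
    {f : NCSeries X} (hf : f ∈ supp Q) : rightNormed deg A f ∈ supp Q := by
  intro w hw
  obtain ⟨u, x, _, hp, hx⟩ := exists_of_rightNormed_ne_zero deg A hw
  exact h _ _ hp (hf _ hx)

theorem rightNormed_eq_zero {f : NCSeries X} (hf : f ∈ supp fun w => ∀ x ∈ w, x ∈ A) :
    rightNormed deg A f = 0 := by
  ext w
  by_contra hw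
  obtain ⟨u, x, hA, _, hx⟩ := exists_of_rightNormed_ne_zero deg A hw
  exact hA (hf _ hx x (by simp))

end NCSeries

namespace NCSeries

variable {X : Type} {deg : X → ℤ} {S : Set X}

/-! ### Lie series -/

theorem _root_.IsLieMonomial.mem_supp {n : ℕ} {p : ℤ} {f : NCSeries X}
    (hf : IsLieMonomial deg S n p f) :
    f ∈ supp fun w => w ≠ [] ∧ wordDegree deg w = p ∧ ∀ x ∈ w, x ∈ S := by
  induction hf with
  | of x hx => exact letter_mem_supp ⟨by simp, by simp, by simpa using hx⟩
  | bracket _ _ h1 h2 =>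
    refine bracket_mem_supp ?_ ?_ _ _ h1 h2
    · rintro u v ⟨hu, hu', hu''⟩ ⟨hv, hv', hv''⟩
      refine ⟨by simp [hu], by simp [hu', hv'], fun x hx => ?_⟩
      rcases List.mem_append.1 hx with h | h
      exacts [hu'' x h, hv'' x h]
    · rintro u v ⟨hu, hu', hu''⟩ ⟨hv, hv', hv''⟩
      refine ⟨by simp [hu], by rw [wordDegree_append, hu', hv', add_comm], fun x hx => ?_⟩
      rcases List.mem_append.1 hx with h | h
      exacts [hu'' x h, hv'' x h]

theorem completeFreeLie_le_supp (p : ℤ) : completeFreeLie deg S p ≤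
    supp fun w => w ≠ [] ∧ wordDegree deg w = p ∧ ∀ x ∈ w, x ∈ S := by
  intro f hf w hw
  have h1 : freeLie deg S w.length p ≤
      supp fun w => w ≠ [] ∧ wordDegree deg w = p ∧ ∀ x ∈ w, x ∈ S :=
    Submodule.span_le.2 fun f hf => IsLieMonomial.mem_supp hf
  exact h1 (hf w.length) w (by rwa [lengthPart_apply, if_pos rfl])

theorem completeFreeLie_le_homogeneous (p : ℤ) :
    completeFreeLie deg S p ≤ homogeneous deg p :=
  (completeFreeLie_le_supp p).trans (supp_mono fun _ h => h.2.1)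

theorem completeFreeLie_le_supp_letters (p : ℤ) :
    completeFreeLie deg S p ≤ supp fun w => ∀ x ∈ w, x ∈ S :=
  (completeFreeLie_le_supp p).trans (supp_mono fun _ h => h.2.2)

theorem nil_of_mem_completeFreeLie {p : ℤ} {f : NCSeries X} (hf : f ∈ completeFreeLie deg S p) :
    f [] = 0 :=
  eq_zero_of_mem_supp (completeFreeLie_le_supp p hf) (by simp)

theorem _root_.IsLieMonomial.mem_completeFreeLie {n : ℕ} {p : ℤ} {f : NCSeries X}
    (hf : IsLieMonomial deg S n p f) : f ∈ completeFreeLie deg S p :=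
  freeLie_le_completeFreeLie deg S n p (Submodule.subset_span hf)

/-- A continuous linear map on the Lie series vanishes when it vanishes on the iterated brackets
of letters. -/
theorem eq_zero_of_isLieMonomial {p : ℤ} (Φ : completeFreeLie deg S p →ₗ[ℚ] NCSeries X)
    (hmono : ∀ n f (hf : IsLieMonomial deg S n p f), Φ ⟨f, hf.mem_completeFreeLie⟩ = 0) (e : ℕ)
    (hcont : ∀ N f, f.1 ∈ supp (fun w => N + e ≤ w.length) → Φ f ∈ supp fun w => N ≤ w.length)
    (f : completeFreeLie deg S p) : Φ f = 0 := by
  have hpoly : ∀ n, (freeLie deg S n p) ≤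
      (LinearMap.ker Φ).map (completeFreeLie deg S p).subtype := fun n =>
    Submodule.span_le.2 fun g hg =>
      ⟨⟨g, IsLieMonomial.mem_completeFreeLie hg⟩, hmono n g hg, rfl⟩
  ext w
  -- The truncation of `f` below length `N + e` is a finite sum of Lie polynomials, which `Φ` kills.
  -- As `Φ` loses at most `e` letters, the tail does not reach the word `w`.
  let N := w.length + 1
  have ht : ∑ i ∈ Finset.range (N + e), lengthPart i f.1 ∈
      (LinearMap.ker Φ).map (completeFreeLie deg S p).subtype :=
    sum_mem fun i _ => hpoly i (f.2 i)
  obtain ⟨t, ht0, ht⟩ := ht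
  have h1 : (f - t).1 ∈ supp fun w => N + e ≤ w.length := by
    intro u hu
    by_contra hlt
    refine hu ?_
    have : t.1 = ∑ i ∈ Finset.range (N + e), lengthPart i f.1 := ht
    rw [Submodule.coe_sub, this, sub_apply, sum_apply, Finset.sum_eq_single u.length]
    · simp [lengthPart_apply]
    · intro i _ hi; simp [lengthPart_apply, hi.symm]
    · intro h; exact absurd (Finset.mem_range.2 (not_le.1 hlt)) h
  have h2 := hcont N _ h1
  rw [map_sub, show Φ t = 0 from ht0, sub_zero] at h2
  exact eq_zero_of_mem_supp h2 (by omega)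

theorem eq_zero_of_isLieMonomial' {p : ℤ} (Φ : NCSeries X →ₗ[ℚ] NCSeries X)
    (hmono : ∀ n f, IsLieMonomial deg S n p f → Φ f = 0) (e : ℕ)
    (hcont : ∀ N f, f ∈ supp (fun w => N + e ≤ w.length) → Φ f ∈ supp fun w => N ≤ w.length)
    {f : NCSeries X} (hf : f ∈ completeFreeLie deg S p) : Φ f = 0 :=
  eq_zero_of_isLieMonomial (Φ ∘ₗ (completeFreeLie deg S p).subtype) (fun n f h => hmono n f h) e
    (fun N f h => hcont N f.1 h) ⟨f, hf⟩

variable [Fintype X]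

/-- An odd derivation with scalar values on the letters annihilates commutators. -/
theorem derivation_smul_one_of_mem {ε : X → ℚ} (hε : ∀ x, ε x ≠ 0 → deg x = -1) {p : ℤ}
    {f : NCSeries X} (hf : f ∈ completeFreeLie deg S p) :
    derivation deg 1 (fun x => ε x • one) f = (∑ x, ε x * f [x]) • one := by
  let L : NCSeries X →ₗ[ℚ] ℚ :=
    { toFun := fun f => ∑ x, ε x * f [x]
      map_add' := fun f g => by simp [mul_add, Finset.sum_add_distrib]
      map_smul' := fun c f => by
        simp only [smul_apply, Finset.mul_sum, RingHom.id_apply, smul_eq_mul]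
        exact Finset.sum_congr rfl fun x _ => by ring }
  rw [← sub_eq_zero]
  -- The loss is `1`, since a scalar value deletes one letter.
  refine eq_zero_of_isLieMonomial' (derivation deg 1 (fun x => ε x • one) - L.smulRight one)
    ?_ 1 ?_ hf
  · clear hf
    intro n f hf
    show _ - L f • one = 0
    -- The degree constraint is carried along because it makes the signs in `[f, g]` match, so that
    -- the terms `L f • g` and `L g • f` cancel.
    suffices h : derivation deg 1 (fun x => ε x • one) f = L f • one ∧ (L f ≠ 0 → p = -1) by
      rw [h.1, sub_self]
    have hL0 : ∀ {p q : ℤ} {f g : NCSeries X}, f [] = 0 → g [] = 0 → L (bracket p q f g) = 0 := by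
      intro p q f g hf hg
      refine Finset.sum_eq_zero fun x _ => ?_
      simp [bracket, mul_cons_shift, mul_nil, hf, hg]
    induction hf with
    | of x hx =>
      have hx : L (letter x) = ε x := by
        show ∑ y, ε y * letter x [y] = ε x
        rw [Finset.sum_eq_single x] <;> simp +contextual [letter]
      rw [derivation_letter, hx]
      exact ⟨rfl, hε x⟩
    | @bracket m n p q f g hf hg h1 h2 =>
      have hf' := hf.mem_completeFreeLie
      have hg' := hg.mem_completeFreeLie
      rw [hL0 (nil_of_mem_completeFreeLie hf') (nil_of_mem_completeFreeLie hg')]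
      refine ⟨?_, fun h => absurd rfl h⟩
      rw [bracket, map_sub, map_smul, derivation_mul deg 1 _ (.inl rfl),
        derivation_mul deg 1 _ (.inl rfl), h1.1, h2.1,
        signTwist_of_homogeneous deg 1 (completeFreeLie_le_homogeneous p hf'),
        signTwist_of_homogeneous deg 1 (completeFreeLie_le_homogeneous q hg')]
      simp only [smul_mul_assoc, mul_smul_comm, one_mul', mul_one', smul_add, smul_smul]
      have e1 : (-1 : ℚ) ^ (p * q) * L f * (-1) ^ (1 * q) = L f := by
        by_cases h : L f = 0
        · simp [h]
        · rw [h1.2 h, mul_right_comm, ← zpow_add₀ (by norm_num)]; simp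
      have e2 : (-1 : ℚ) ^ (p * q) * L g = L g * (-1) ^ (1 * p) := by
        by_cases h : L g = 0
        · simp [h]
        · rw [h2.2 h, mul_comm]; congr 1; exact neg_one_zpow_eq ⟨-p, by ring⟩
      rw [zero_smul]
      simp only [← mul_assoc, e1, e2]
      abel
  · intro N f hf
    refine sub_mem (derivation_mem_supp deg 1 _ ?_ hf) ?_
    · intro u x s t _ h; simp at h ⊢; omega
    · intro w hw
      have : L f ≠ 0 := left_ne_zero_of_mul hw
      obtain ⟨x, _, hx⟩ := Finset.exists_ne_zero_of_sum_ne_zero this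
      have := hf _ (right_ne_zero_of_mul hx)
      simp at this
      omega

variable (A : Set X)

/-- Right-normed bracketing intertwines the multiplication by a Lie series with its adjoint
action. -/
theorem rightNormed_mul {p : ℤ} {l : NCSeries X} (hl : l ∈ completeFreeLie deg S p)
    {f : NCSeries X} (hf : f [] = 0) :
    rightNormed deg A (l * f) = commutator deg p l (rightNormed deg A f) := by
  rw [← sub_eq_zero]
  refine eq_zero_of_isLieMonomial' (rightNormed deg A ∘ₗ LinearMap.mulRight ℚ f -
    (commutator deg p).flip (rightNormed deg A f)) ?_ 0 ?_ hl
  · clear hl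
    intro n l hl
    show rightNormed deg A (l * f) - commutator deg p l (rightNormed deg A f) = 0
    rw [sub_eq_zero]
    induction hl generalizing f with
    | of x hx => exact rightNormed_letter_mul deg A x hf
    -- Left multiplication and the adjoint action both turn brackets into graded commutators of
    -- operators, so agreement on letters propagates to all iterated brackets.
    | @bracket m n p q g h hg hh ih1 ih2 =>
      rw [commutator_bracket deg (completeFreeLie_le_homogeneous p hg.mem_completeFreeLie)
        (completeFreeLie_le_homogeneous q hh.mem_completeFreeLie), ← ih1 hf, ← ih2 hf,
        ← ih1 (by rw [mul_nil, hf, mul_zero]), ← ih2 (by rw [mul_nil, hf, mul_zero]), bracket,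
        sub_mul, smul_mul_assoc, map_sub, map_smul, mul_assoc, mul_assoc]
  · intro N g hg
    refine sub_mem ?_ ?_
    · exact rightNormed_mem_supp deg A (fun u v h hu => by rwa [← h.length_eq])
        (mul_mem_supp (R := fun _ => True) (fun u v hu _ => by simp; omega) hg (fun _ _ => trivial))
    · exact commutator_mem_supp deg (R := fun _ => True) (fun u v hu _ => by simp; omega)
        (fun u v _ hu => by simp; omega) p hg (fun _ _ => trivial)

/-- A form of the theorem of Dynkin, Specht and Wever. -/
theorem rightNormed_of_mem {p : ℤ} {l : NCSeries X} (hl : l ∈ completeFreeLie deg S p) :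
    rightNormed deg A l = countOuter A l := by
  rw [← sub_eq_zero]
  refine eq_zero_of_isLieMonomial' (rightNormed deg A - countOuter A) ?_ 0 ?_ hl
  · clear hl
    intro n l hl
    rw [LinearMap.sub_apply, sub_eq_zero]
    induction hl with
    | of x hx =>
      by_cases hA : x ∈ A
      · have : letter x ∈ supp fun w => ∀ x ∈ w, x ∈ A := letter_mem_supp (by simpa using hA)
        rw [rightNormed_eq_zero deg A this, countOuter_eq_zero A this]
      · rw [rightNormed_letter deg A x hA, countOuter_letter A x hA]
    | @bracket m n p q f g hf hg h1 h2 =>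
      have hf' := hf.mem_completeFreeLie
      have hg' := hg.mem_completeFreeLie
      -- By `rightNormed_mul` and induction, bracketing sends `[f, g]` to `[f, N g] + [N f, g]`,
      -- which is `N [f, g]` because `N = countOuter A` is a derivation.
      rw [bracket, map_sub, map_smul, rightNormed_mul A hf' (nil_of_mem_completeFreeLie hg'),
        rightNormed_mul A hg' (nil_of_mem_completeFreeLie hf'), h1, h2,
        commutator_of_homogeneous deg f (q := q)
          (countOuter_mem_supp A (completeFreeLie_le_homogeneous q hg')),
        commutator_of_homogeneous deg g (q := p)
          (countOuter_mem_supp A (completeFreeLie_le_homogeneous p hf')),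
        map_sub, map_smul, countOuter_mul, countOuter_mul, bracket, bracket, mul_comm q p]
      simp only [smul_sub, smul_add, smul_smul, neg_one_zpow_mul_self, one_smul]
      abel
  · intro N g hg
    exact sub_mem (rightNormed_mem_supp deg A (fun u v h hu => by rwa [← h.length_eq]) hg)
      (countOuter_mem_supp A hg)

/-- The recursion `rightNormed_eq` writes each length part as a sum of multiples of letters and
brackets of a letter with a shorter Lie element. -/
theorem rightNormed_mem {p : ℤ} {f : NCSeries X} (hf : f ∈ homogeneous deg p)
    (hS : f ∈ supp fun w => ∀ x ∈ w, x ∈ S) :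
    rightNormed deg A f ∈ completeFreeLie deg S p := by
  intro n
  induction n generalizing p f with
  | zero =>
    have : lengthPart 0 (rightNormed deg A f) = 0 := by
      ext w
      rw [lengthPart_apply]
      split_ifs with h
      · rw [List.length_eq_zero_iff.1 h, rightNormed_nil]; rfl
      · rfl
    rw [this]; exact zero_mem _
  | succ n ih =>
    rw [rightNormed_eq, map_add, map_sum, map_sum]
    refine add_mem (sum_mem fun x _ => ?_) (sum_mem fun x _ => ?_)
    · split_ifs with hA
      · rw [map_zero]; exact zero_mem _
      · rw [map_smul, lengthPart_letter]
        split_ifs with hn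
        · by_cases h : f [x] = 0
          · rw [h, zero_smul]; exact zero_mem _
          · have hp : deg x = p := by simpa using hf _ h
            rw [hn, ← hp]
            exact Submodule.smul_mem _ _ (Submodule.subset_span (.of x (hS _ h x (by simp))))
        · rw [smul_zero]; exact zero_mem _
    · rw [lengthPart_commutator_letter]
      by_cases hx : x ∈ S
      · have h1 : shift x f ∈ homogeneous deg (p - deg x) := fun w hw => by
          have : wordDegree deg (x :: w) = p := hf _ hw
          rw [wordDegree_cons] at this
          show wordDegree deg w = p - deg x
          omega
        have h2 : shift x f ∈ supp fun w => ∀ x ∈ w, x ∈ S := fun w hw y hy =>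
          hS _ hw y (by simp [hy])
        have h3 : rightNormed deg A (shift x f) ∈ homogeneous deg (p - deg x) :=
          rightNormed_mem_supp deg A (fun u v h hu => by
            exact ((h.map deg).sum_eq).symm.trans hu) h1
        rw [commutator_of_homogeneous deg (q := p - deg x)]
        · have := bracket_mem_freeLie (Submodule.subset_span (.of x hx)) (ih h1 h2)
          rwa [add_comm 1 n, add_sub_cancel] at this
        · intro w hw
          rw [lengthPart_apply] at hw
          split_ifs at hw with h
          · exact h3 w hw
          · exact absurd rfl hw
      · have : shift x f = 0 := by
          ext w
          by_contra hw
          exact hx (hS _ hw x (by simp))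
        rw [this, map_zero, map_zero, map_zero]; exact zero_mem _

end NCSeries

/-! ### The contracting homotopy for the twisted differential -/

namespace NCSeries

variable {X : Type}

/-- Values `φ` on the letters of a differential on the complete free Lie algebra that is twisted by
the letter `a`, and preserves, before the twist, the subalgebras on `A` and on `Aᶜ`; `ε` is a
functional on the letters that vanishes on boundaries, and takes the value `1` on `a`. -/
structure IsTwistedDifferential (deg : X → ℤ) (A : Set X) (a : X) (ε : X → ℚ)
    (φ : X → NCSeries X) [Fintype X] : Prop where
  mem_lie : ∀ x, φ x ∈ completeFreeLie deg Set.univ (deg x - 1)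
  inner : ∀ x ∈ A, φ x ∈ supp fun w => ∀ y ∈ w, y ∈ A
  outer : ∀ x ∉ A, φ x - bracket (-1) (deg x) (letter a) (letter x) ∈
    supp fun w => w ≠ [] ∧ ∀ y ∈ w, y ∉ A
  augmentation_base : ε a = 1
  augmentation_ne_zero : ∀ x, ε x ≠ 0 → x ∈ A ∧ deg x = -1
  augmentation_boundary : ∀ x, ∑ y, ε y * φ x [y] = 0

variable [Fintype X] {deg : X → ℤ} {A : Set X} {a : X} {ε : X → ℚ} {φ : X → NCSeries X}

/-- Words of length one are set apart so that the factor after the first letter has no constant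
term, as the rules for `letter x * g` require. -/
theorem eq_add_sum_letter_mul (f : NCSeries X) :
    f = f [] • one + ∑ x, (f [x] • letter x + letter x * (shift x f - (f [x] : ℚ) • one)) := by
  conv_lhs => rw [← add_sub_cancel ((f [] : ℚ) • one) f,
    eq_sum_letter_mul_shift (f - (f [] : ℚ) • one) (sub_const_nil f)]
  congr 1
  refine Finset.sum_congr rfl fun x _ => ?_
  have h : shift x (one : NCSeries X) = 0 := by ext u; simp [shift_apply]
  rw [map_sub, map_smul, h, smul_zero, sub_zero, mul_sub, mul_smul_comm, mul_one',
    add_sub_cancel]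

/-- The only letter is the last one, which is never deleted. -/
theorem derivation_zero_letter (c : X → ℚ) (x : X) :
    derivation deg 0 (fun y => c y • one) (letter x) = 0 := by
  ext w
  cases w with
  | nil => rw [derivation_nil, zero_mul]; rfl
  | cons y w =>
    have h0 : derivation deg 0 (fun y => c y • one) (shift y (letter x)) = 0 := by
      by_cases hy : y = x
      · rw [hy, shift_letter_self, derivation_one]
      · rw [shift_letter_of_ne hy, map_zero]
    rw [derivation_cons, h0, Finset.sum_eq_zero]
    · simp
    · intro z _
      rw [smul_mul_assoc, one_mul', smul_apply]
      by_cases hz : z = x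
      · rw [hz, shift_letter_self]; simp
      · rw [shift_letter_of_ne hz]; simp

namespace IsTwistedDifferential

section

variable (h : IsTwistedDifferential deg A a ε φ)
include h

theorem homogeneous_apply (x : X) : φ x ∈ homogeneous deg (deg x - 1) :=
  completeFreeLie_le_homogeneous _ (h.mem_lie x)

theorem apply_nil (x : X) : φ x [] = 0 := nil_of_mem_completeFreeLie (h.mem_lie x)

theorem derivation_nil_eq_zero (f : NCSeries X) : derivation deg 1 φ f [] = 0 := by
  rw [derivation_nil, Finset.sum_eq_zero, mul_zero]
  intro x _; rw [h.apply_nil, zero_mul]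

/-- Deletion of letters, the last included, annihilates commutators. On the Lie series `φ x` it
therefore sees only the linear part, on which `ε` vanishes. -/
theorem contraction_apply (x : X) : derivation deg 1 (fun x => ε x • one) (φ x) = 0 := by
  rw [derivation_smul_one_of_mem (fun x hx => (h.augmentation_ne_zero x hx).2) (h.mem_lie x),
    h.augmentation_boundary, zero_smul]

/-- The operator `K ∂ + ∂ K` commutes with the left multiplication by letters. -/
theorem homotopy_letter_mul (x : X) {f : NCSeries X} (hf : f [] = 0) :
    derivation deg 0 (fun x => ε x • one) (derivation deg 1 φ (letter x * f)) +
      derivation deg 1 φ (derivation deg 0 (fun x => ε x • one) (letter x * f)) =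
    letter x * (derivation deg 0 (fun x => ε x • one) (derivation deg 1 φ f) +
      derivation deg 1 φ (derivation deg 0 (fun x => ε x • one) f)) := by
  have hd := h.derivation_nil_eq_zero f
  have e1 : (-1 : ℚ) ^ (1 * (deg x - 1)) = -(-1 : ℚ) ^ (1 * deg x) := by
    rw [one_mul, one_mul, zpow_sub₀ (by norm_num)]; simp [div_neg]
  -- Both `K ∂` and `∂ K` produce a multiple of `∂ f` with coefficient `± ε x`. The two cancel
  -- because `ε` is concentrated in degree `-1`.
  have e2 : ε x + (-1 : ℚ) ^ (1 * deg x) * ε x = 0 := by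
    by_cases hx : ε x = 0
    · simp [hx]
    · rw [(h.augmentation_ne_zero x hx).2]; norm_num
  rw [derivation_mul deg 1 φ (.inl rfl), derivation_mul deg 0 _ (.inr hf), map_add, map_add,
    derivation_mul deg 0 _ (.inr hf), derivation_letter, derivation_letter, h.contraction_apply,
    signTwist_of_homogeneous deg 1 (letter_homogeneous deg x),
    signTwist_of_homogeneous deg 1 (h.homogeneous_apply x), e1]
  simp only [smul_mul_assoc, map_smul, one_mul', zero_mul, zero_add]
  rw [derivation_mul deg 0 _ (.inr hd), derivation_mul deg 1 φ (.inl rfl), derivation_letter,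
    derivation_letter, signTwist_of_homogeneous deg 1 (letter_homogeneous deg x)]
  simp only [smul_mul_assoc, one_mul', smul_add, smul_smul, neg_one_zpow_mul_self, one_smul,
    neg_smul, mul_add]
  have e3 := congrArg (fun c : ℚ => c • derivation deg 1 φ f) e2
  simp only [add_smul, zero_smul] at e3
  rw [eq_neg_of_add_eq_zero_left e3]
  abel

/-- For `x ∈ A`, deleting letters from `φ x` leaves words in `A`, which `rightNormed` kills. For `x
∉ A`, the part of `φ x` other than `[a, x]` contains nothing that `ε` detects, and deleting `a` from
`[a, x]` returns `x`. -/
theorem rightNormed_homotopy_letter (x : X) :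
    rightNormed deg A (derivation deg 0 (fun x => ε x • one) (derivation deg 1 φ (letter x)) +
      derivation deg 1 φ (derivation deg 0 (fun x => ε x • one) (letter x))) =
    rightNormed deg A (letter x) := by
  rw [derivation_zero_letter, map_zero, add_zero, derivation_letter]
  by_cases hx : x ∈ A
  · rw [rightNormed_eq_zero deg A (letter_mem_supp (by simpa using hx)),
      rightNormed_eq_zero deg A (derivation_mem_supp deg 0 _ ?_ (h.inner x hx))]
    intro u y s t hs hw
    have : s = [] := by
      by_contra hne
      obtain ⟨z, s, rfl⟩ := List.exists_cons_of_ne_nil hne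
      simp at hs
    subst this
    intro z hz
    exact hw z (by simp at hz ⊢; tauto)
  · congr 1
    have h1 : derivation deg 0 (fun x => ε x • one)
        (φ x - bracket (-1) (deg x) (letter a) (letter x)) = 0 := by
      have := derivation_mem_supp deg 0 (fun x => ε x • one) (R := fun _ => False) ?_ (h.outer x hx)
      · ext w
        exact eq_zero_of_mem_supp this id
      · intro u y s t hs hw
        exact hw.2 y (by simp) (h.augmentation_ne_zero y (left_ne_zero_of_mul hs)).1
    have h2 : ε x = 0 := by
      by_contra h'; exact hx (h.augmentation_ne_zero x h').1
    rw [map_sub, sub_eq_zero] at h1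
    rw [h1, bracket, map_sub, map_smul, derivation_mul deg 0 _ (.inr (letter_nil x)),
      derivation_mul deg 0 _ (.inr (letter_nil a)), derivation_zero_letter, derivation_zero_letter,
      derivation_letter, derivation_letter,
      h.augmentation_base, h2, one_smul, one_mul']
    simp

/-- Up to words that end in `A`, the operator `K` contracts the differential. -/
theorem rightNormed_homotopy {f : NCSeries X} (hf : f [] = 0) :
    rightNormed deg A (derivation deg 0 (fun x => ε x • one) (derivation deg 1 φ f) +
      derivation deg 1 φ (derivation deg 0 (fun x => ε x • one) f)) = rightNormed deg A f := by
  let W : NCSeries X →ₗ[ℚ] NCSeries X :=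
    derivation deg 0 (fun x => ε x • one) ∘ₗ derivation deg 1 φ +
      derivation deg 1 φ ∘ₗ derivation deg 0 (fun x => ε x • one)
  have hW0 : ∀ g, W g [] = 0 := fun g => by
    show derivation deg 0 (fun x => ε x • one) (derivation deg 1 φ g) [] +
      derivation deg 1 φ (derivation deg 0 (fun x => ε x • one) g) [] = 0
    rw [derivation_nil, zero_mul, h.derivation_nil_eq_zero, add_zero]
  have hWl : ∀ x, rightNormed deg A (W (letter x)) = rightNormed deg A (letter x) :=
    h.rightNormed_homotopy_letter
  have hWm : ∀ (x : X) {g : NCSeries X}, g [] = 0 → W (letter x * g) = letter x * W g :=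
    fun x g hg => h.homotopy_letter_mul x hg
  -- `W` passes a first letter and bracketing turns that letter into `ad_x`, so the claim for words
  -- up to length `n + 1` follows from the claim up to length `n`.
  suffices H : ∀ (n : ℕ) (f : NCSeries X), f [] = 0 → ∀ w : List X, w.length ≤ n →
      rightNormed deg A (W f) w = rightNormed deg A f w by
    ext w; exact H _ f hf w le_rfl
  intro n
  induction n with
  | zero =>
    intro f _ w hw
    rw [List.length_eq_zero_iff.1 (Nat.le_zero.1 hw), rightNormed_nil, rightNormed_nil]
  | succ n ih =>
    intro f hf w hw
    rw [eq_add_sum_letter_mul f, hf, zero_smul, zero_add]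
    simp only [map_sum, map_add, map_smul, sum_apply, add_apply]
    refine Finset.sum_congr rfl fun x _ => ?_
    have hg : (shift x f - (f [x] : ℚ) • one : NCSeries X) [] = 0 := sub_const_nil (shift x f)
    rw [hWl, hWm x hg, rightNormed_letter_mul deg A x (hW0 _), rightNormed_letter_mul deg A x hg]
    congr 1
    exact commutator_letter_congr deg _ x (fun u hu => ih _ hg u hu) hw

/-- Right-normed bracketing commutes with the differential on the associated graded of the
filtration by the number of letters outside of `A`. -/
theorem rightNormed_derivation_sub_mem {k : ℕ} {f : NCSeries X} (hf : f ∈ outerFiltration A k) :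
    rightNormed deg A (derivation deg 1 φ f) - derivation deg 1 φ (rightNormed deg A f) ∈
      outerFiltration A (k + 1) := by
  let E : NCSeries X →ₗ[ℚ] NCSeries X :=
    rightNormed deg A ∘ₗ derivation deg 1 φ - derivation deg 1 φ ∘ₗ rightNormed deg A
  have hE1 : E one = 0 := by
    show rightNormed deg A (derivation deg 1 φ one) - derivation deg 1 φ (rightNormed deg A one) = 0
    rw [derivation_one, rightNormed_one, map_zero, map_zero, sub_zero]
  have hEl : ∀ x, E (letter x) ∈ outerFiltration A (outerCount A [x] + 1) := by
    intro x
    show rightNormed deg A (derivation deg 1 φ (letter x)) -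
      derivation deg 1 φ (rightNormed deg A (letter x)) ∈ _
    rw [derivation_letter]
    by_cases hx : x ∈ A
    · rw [rightNormed_eq_zero deg A (h.inner x hx),
        rightNormed_eq_zero deg A (letter_mem_supp (by simpa using hx)), map_zero, sub_zero]
      exact zero_mem _
    · rw [rightNormed_letter deg A x hx, derivation_letter, rightNormed_of_mem A (h.mem_lie x)]
      -- Here `E (letter x)` equals `N (φ x) - φ x`. Every word of `φ x` has an outer letter, and `N
      -- - 1` kills those with exactly one, so two outer letters remain.
      have h1 : φ x ∈ outerFiltration A 1 := by
        rw [← sub_add_cancel (φ x) (bracket (-1) (deg x) (letter a) (letter x))]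
        refine add_mem (supp_mono ?_ (h.outer x hx)) ?_
        · rintro w ⟨hw, hw'⟩
          rw [outerCount_eq_length A hw']
          exact List.length_pos_iff.2 hw
        · exact bracket_mem_supp (Q := fun _ => True) (fun u v _ hv => by simp; omega)
            (fun u v hv _ => by simp; omega) _ _ (fun _ _ => trivial)
            (letter_mem_supp (Q := fun w => 1 ≤ outerCount A w) (by simp [hx]))
      have := neg_mem (smul_sub_countOuter_mem A h1)
      simpa [hx] using this
  -- As `φ x` is a Lie series, `rightNormed_mul` turns `φ x * g` into the bracket of `φ x` with the
  -- bracketing of `g`. The Leibniz rule gives the same term on the other side, so it cancels.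
  have hEm : ∀ (x : X) {g : NCSeries X}, g [] = 0 → E (letter x * g) =
      (-1 : ℚ) ^ deg x • commutator deg (deg x) (letter x) (E g) := by
    intro x g hg
    show rightNormed deg A (derivation deg 1 φ (letter x * g)) -
      derivation deg 1 φ (rightNormed deg A (letter x * g)) = _ • commutator deg (deg x) (letter x)
        (rightNormed deg A (derivation deg 1 φ g) - derivation deg 1 φ (rightNormed deg A g))
    rw [derivation_mul deg 1 φ (.inl rfl), map_add, derivation_letter,
      rightNormed_mul A (h.mem_lie x) hg, signTwist_of_homogeneous deg 1 (letter_homogeneous deg x),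
      smul_mul_assoc, map_smul, rightNormed_letter_mul deg A x (h.derivation_nil_eq_zero g),
      rightNormed_letter_mul deg A x hg,
      derivation_commutator deg φ h.homogeneous_apply (letter_homogeneous deg x),
      derivation_letter, one_mul, map_sub, smul_sub]
    abel
  suffices H : ∀ (n k : ℕ) (f : NCSeries X), f ∈ outerFiltration A k →
      E f ∈ supp fun w => w.length ≤ n → k + 1 ≤ outerCount A w by
    exact fun w hw => H w.length k f hf w hw le_rfl
  -- This reduces the claim to products `letter x * g`: constants contribute nothing, and single
  -- letters are handled by `hEl`.
  have key : ∀ (n k : ℕ) (f : NCSeries X), f ∈ outerFiltration A k →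
      (∀ (j : ℕ) (x : X) (g : NCSeries X), g [] = 0 → g ∈ outerFiltration A j →
        k ≤ j + outerCount A [x] →
        E (letter x * g) ∈ supp fun w => w.length ≤ n → k + 1 ≤ outerCount A w) →
      E f ∈ supp fun w => w.length ≤ n → k + 1 ≤ outerCount A w := by
    intro n k f hf H
    rw [eq_add_sum_letter_mul f, map_add, map_smul, hE1, smul_zero, zero_add, map_sum]
    refine sum_mem fun x _ => ?_
    rw [map_add, map_smul]
    -- Removing the first letter costs at most one outer letter. Truncated subtraction is harmless
    -- when `k = 0`.
    refine add_mem ?_ (H (k - outerCount A [x]) x _ (sub_const_nil (shift x f)) ?_ (by omega))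
    · by_cases hx : f [x] = 0
      · rw [hx, zero_smul]; exact zero_mem _
      · have := hf _ hx
        exact Submodule.smul_mem _ _ (supp_mono (fun w hw _ => by omega) (hEl x))
    · intro w hw
      cases w with
      | nil => exact absurd (sub_const_nil (shift x f)) hw
      | cons y w =>
        have h1 : f (x :: y :: w) ≠ 0 := by
          intro h0
          apply hw
          simp [shift_apply, h0]
        have : k ≤ outerCount A ([x] ++ y :: w) := hf _ h1
        rw [outerCount_append] at this
        omega
  intro n
  induction n with
  | zero =>
    intro k f hf
    refine key 0 k f hf fun j x g hg _ _ => ?_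
    rw [hEm x hg]
    intro w hw hl
    rw [List.length_eq_zero_iff.1 (Nat.le_zero.1 hl)] at hw
    exact absurd (by rw [smul_apply, commutator_apply]; simp [mul_nil, letter_nil]) hw
  | succ n ih =>
    intro k f hf
    refine key (n + 1) k f hf fun j x g hg hgj hj => ?_
    rw [hEm x hg]
    refine Submodule.smul_mem _ _ (commutator_mem_supp deg (Q := fun w => w = [x]) ?_ ?_ _
      (letter_mem_supp rfl) (ih j g hgj))
    · rintro u v rfl hv hl
      have := hv (by simpa using hl)
      rw [outerCount_append]; omega
    · rintro v u hv rfl hl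
      have := hv (by simpa using hl)
      rw [outerCount_append]; omega

end

end IsTwistedDifferential

end NCSeries

namespace NCSeries

variable {X : Type} {deg : X → ℤ} {A : Set X}

/-! ### The part of a series on words in `A` -/

open scoped Classical in
/-- The part of a series supported on the words in the letters `x ∈ A`. -/
def innerPart (A : Set X) : NCSeries X →ₗ[ℚ] NCSeries X where
  toFun f := fun w => if ∀ x ∈ w, x ∈ A then f w else 0
  map_add' f g := by
    ext w
    show (if ∀ x ∈ w, x ∈ A then f w + g w else 0) =
      (if ∀ x ∈ w, x ∈ A then f w else 0) + (if ∀ x ∈ w, x ∈ A then g w else 0)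
    split_ifs <;> simp
  map_smul' c f := by
    ext w
    show (if ∀ x ∈ w, x ∈ A then c * f w else 0) = c * (if ∀ x ∈ w, x ∈ A then f w else 0)
    split_ifs <;> simp

open scoped Classical in
theorem innerPart_apply (f : NCSeries X) (w : List X) :
    innerPart A f w = if ∀ x ∈ w, x ∈ A then f w else 0 := rfl

theorem innerPart_mem_supp (f : NCSeries X) :
    innerPart A f ∈ supp fun w => ∀ x ∈ w, x ∈ A := by
  intro w hw
  by_contra h
  exact hw (by rw [innerPart_apply, if_neg h])

theorem innerPart_mul (f g : NCSeries X) :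
    innerPart A (f * g) = innerPart A f * innerPart A g := by
  ext w
  rw [innerPart_apply, mul_apply, mul_apply]
  by_cases h : ∀ x ∈ w, x ∈ A
  · rw [if_pos h]
    refine Finset.sum_congr rfl fun i _ => ?_
    rw [innerPart_apply, innerPart_apply, if_pos fun x hx => h x (List.mem_of_mem_take hx),
      if_pos fun x hx => h x (List.mem_of_mem_drop hx)]
  · rw [if_neg h]
    symm
    refine Finset.sum_eq_zero fun i _ => ?_
    by_contra hne
    apply h
    intro x hx
    rw [← List.take_append_drop i w, List.mem_append] at hx
    rcases hx with hx | hx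
    · exact innerPart_mem_supp _ _ (left_ne_zero_of_mul hne) x hx
    · exact innerPart_mem_supp _ _ (right_ne_zero_of_mul hne) x hx

theorem innerPart_of_mem {f : NCSeries X} (hf : f ∈ supp fun w => ∀ x ∈ w, x ∈ A) :
    innerPart A f = f := by
  ext w
  rw [innerPart_apply]
  split_ifs with h
  · rfl
  · exact (eq_zero_of_mem_supp hf h).symm

theorem sub_innerPart_mem (f : NCSeries X) : f - innerPart A f ∈ outerFiltration A 1 := by
  intro w hw
  rw [Nat.one_le_iff_ne_zero]
  intro h
  rw [sub_apply, innerPart_apply, if_pos ((outerCount_eq_zero_iff A).1 h), sub_self] at hw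
  exact hw rfl

theorem eq_zero_of_inner_of_outer {f : NCSeries X} (hf : f ∈ supp fun w => ∀ x ∈ w, x ∈ A)
    (hf' : f ∈ outerFiltration A 1) : f = 0 := by
  ext w
  by_contra h
  have h1 : 1 ≤ outerCount A w := hf' w h
  rw [(outerCount_eq_zero_iff A).2 (hf w h)] at h1
  omega

/-- Setting the letters outside of `A` to zero is multiplicative (`innerPart_mul`), so it carries
iterated brackets to iterated brackets or to zero. -/
theorem innerPart_mem {S : Set X} {p : ℤ} {f : NCSeries X} (hf : f ∈ completeFreeLie deg S p) :
    innerPart A f ∈ completeFreeLie deg A p := by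
  intro n
  have h1 : lengthPart n (innerPart A f) = innerPart A (lengthPart n f) := by
    ext w
    simp only [lengthPart_apply, innerPart_apply]
    split_ifs <;> rfl
  rw [h1]
  have h2 : freeLie deg S n p ≤ (freeLie deg A n p).comap (innerPart A) := by
    refine Submodule.span_le.2 fun g hg => ?_
    have hg' : IsLieMonomial deg S n p g := hg
    clear hg hf h1
    show innerPart A g ∈ freeLie deg A n p
    induction hg' with
    | of x hx =>
      by_cases hA : x ∈ A
      · rw [innerPart_of_mem (letter_mem_supp (by simpa using hA))]
        exact Submodule.subset_span (.of x hA)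
      · have : innerPart A (letter x) = 0 := by
          ext w
          rw [innerPart_apply]
          split_ifs with h
          · by_contra hw
            have : w = [x] := letter_mem_supp (Q := fun v => v = [x]) rfl w hw
            exact hA (h x (by simp [this]))
          · rfl
        rw [this]; exact zero_mem _
    | bracket _ _ h1 h2 =>
      rw [bracket, map_sub, map_smul, innerPart_mul, innerPart_mul]
      exact bracket_mem_freeLie h1 h2
  exact h2 (hf n)

variable [Fintype X] {a : X} {ε : X → ℚ} {φ : X → NCSeries X} {S : Set X}

/-- A continuous differential on a complete free Lie algebra is the restriction of a derivation of
the algebra of noncommutative power series. -/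
theorem d_eq_derivation (D : CompleteFreeDGL deg S)
    (hφ : ∀ x, φ x ∈ completeFreeLie deg Set.univ (deg x - 1))
    (hD : ∀ x (hx : x ∈ S), (D.d (deg x) ⟨letter x, letter_mem hx rfl⟩).1 = φ x)
    (hcont : ∀ p N (f : completeFreeLie deg S p), f.1 ∈ supp (fun w => N ≤ w.length) →
      (D.d p f).1 ∈ supp fun w => N ≤ w.length) (p : ℤ) (f : completeFreeLie deg S p) :
    (D.d p f).1 = derivation deg 1 φ f.1 := by
  have hhom : ∀ x, φ x ∈ homogeneous deg (deg x - 1) := fun x =>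
    completeFreeLie_le_homogeneous _ (hφ x)
  rw [← sub_eq_zero]
  refine eq_zero_of_isLieMonomial ((completeFreeLie deg S (p - 1)).subtype ∘ₗ D.d p -
    derivation deg 1 φ ∘ₗ (completeFreeLie deg S p).subtype) ?_ 0 ?_ f
  · clear f
    intro n f hf
    show (D.d p ⟨f, hf.mem_completeFreeLie⟩).1 - derivation deg 1 φ f = 0
    rw [sub_eq_zero]
    induction hf with
    | of x hx => rw [derivation_letter]; exact hD x hx
    | @bracket m n p q f g hf hg h1 h2 =>
      have hf' := hf.mem_completeFreeLie
      have hg' := hg.mem_completeFreeLie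
      refine (D.leibniz p q ⟨f, hf'⟩ ⟨g, hg'⟩).trans ?_
      rw [← commutator_of_homogeneous deg f (completeFreeLie_le_homogeneous q hg'),
        derivation_commutator deg φ hhom (completeFreeLie_le_homogeneous p hf'), ← h1, ← h2,
        commutator_of_homogeneous deg _ (completeFreeLie_le_homogeneous q hg'),
        commutator_of_homogeneous deg _ (completeFreeLie_le_homogeneous (q - 1) (D.d q _).2)]
  · intro N f hf
    refine sub_mem (hcont p N f hf) (derivation_mem_supp deg 1 φ ?_ hf)
    intro u x s t hs h
    have : s ≠ [] := fun h0 => hs (h0 ▸ nil_of_mem_completeFreeLie (hφ x))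
    have := List.length_pos_iff.2 this
    simp at h ⊢
    omega

/-! ### Acyclicity of the part with letters outside of `A` -/

namespace IsTwistedDifferential

variable (h : IsTwistedDifferential deg A a ε φ)
include h

/-- An outer letter `x` is replaced either by a word of `[a, x]`, which still contains `x`, or by a
nonempty word of outer letters; replacing a letter of `A` cannot lower the count. -/
theorem derivation_mem_outerFiltration {k : ℕ} {f : NCSeries X} (hf : f ∈ outerFiltration A k) :
    derivation deg 1 φ f ∈ outerFiltration A k := by
  refine derivation_mem_supp deg 1 φ ?_ hf
  intro u x s t hs hk
  rw [outerCount_append, outerCount_cons] at hk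
  rw [outerCount_append, outerCount_append]
  by_cases hx : x ∈ A
  · rw [if_pos hx] at hk; omega
  · rw [if_neg hx] at hk
    suffices 1 ≤ outerCount A s by omega
    by_cases h1 : (φ x - bracket (-1) (deg x) (letter a) (letter x)) s = 0
    · rw [sub_apply, sub_eq_zero] at h1
      rw [h1] at hs
      exact bracket_mem_supp (Q := fun _ => True) (R := fun w => 1 ≤ outerCount A w)
        (T := fun w => 1 ≤ outerCount A w) (fun u v _ hv => by simp; omega)
        (fun u v hv _ => by simp; omega) _ _ (fun _ _ => trivial)
        (letter_mem_supp (by simp [hx])) s hs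
    · obtain ⟨hs, hs'⟩ := h.outer x hx s h1
      rw [outerCount_eq_length A hs']
      exact List.length_pos_iff.2 hs

/-- One step of the construction of a primitive. -/
theorem sub_derivation_mem {k : ℕ} (hk : k ≠ 0) {p : ℤ} {z : NCSeries X}
    (hz : z ∈ completeFreeLie deg S p) (hzk : z ∈ outerFiltration A k)
    (hdz : derivation deg 1 φ z = 0) :
    z - derivation deg 1 φ ((k : ℚ)⁻¹ • rightNormed deg A
      (derivation deg 0 (fun x => ε x • one) z)) ∈ outerFiltration A (k + 1) := by
  -- Only letters of `A` are ever deleted.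
  have hK : derivation deg 0 (fun x => ε x • one) z ∈ outerFiltration A k := by
    refine derivation_mem_supp deg 0 _ ?_ hzk
    intro u x s t hs hk
    have hx := (h.augmentation_ne_zero x (left_ne_zero_of_mul hs)).1
    rw [outerCount_append, outerCount_cons, if_pos hx] at hk
    rw [outerCount_append, outerCount_append]
    omega
  have h1 := h.rightNormed_homotopy (nil_of_mem_completeFreeLie hz)
  rw [hdz, map_zero, zero_add, rightNormed_of_mem A hz] at h1
  have h2 := h.rightNormed_derivation_sub_mem hK
  rw [h1] at h2
  -- Both `k z - N z` and `N z - ∂ r K z` lie one step deeper in the filtration; their sum is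
  -- divided by `k`.
  have h3 := smul_sub_countOuter_mem A hzk
  have h4 := Submodule.smul_mem _ (k : ℚ)⁻¹ (add_mem h3 h2)
  rw [sub_add_sub_cancel, smul_sub, smul_smul, inv_mul_cancel₀ (by exact_mod_cast hk), one_smul,
    ← map_smul] at h4
  exact h4

/-- The deleted letters have degree `-1`, so the degree rises by one; bracketing then restores a Lie
series. -/
theorem rightNormed_contraction_mem {p : ℤ} {z : NCSeries X} (hz : z ∈ completeFreeLie deg S p) :
    rightNormed deg A (derivation deg 0 (fun x => ε x • one) z) ∈
      completeFreeLie deg S (p + 1) := by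
  have hs : ∀ {x : X} {s : List X}, (ε x • one : NCSeries X) s ≠ 0 → s = [] := by
    intro x s hs
    by_contra hne
    obtain ⟨z, s, rfl⟩ := List.exists_cons_of_ne_nil hne
    simp at hs
  refine rightNormed_mem A (derivation_mem_supp deg 0 _ ?_ (completeFreeLie_le_homogeneous p hz))
    (derivation_mem_supp deg 0 _ ?_ (completeFreeLie_le_supp_letters p hz))
  · intro u x s t hx hw
    obtain rfl := hs hx
    have := (h.augmentation_ne_zero x (left_ne_zero_of_mul hx)).2
    rw [wordDegree_append, wordDegree_cons] at hw
    rw [List.nil_append, wordDegree_append]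
    omega
  · intro u x s t hx hw y hy
    obtain rfl := hs hx
    exact hw y (by simp at hy ⊢; tauto)

/-- Cycles of the complete free Lie algebra all of whose words have letters outside of `A` are
boundaries. -/
theorem exists_derivation_eq
    (hS : ∀ q, ∀ y ∈ completeFreeLie deg S q, derivation deg 1 φ y ∈ completeFreeLie deg S (q - 1))
    (hdd : ∀ q, ∀ y ∈ completeFreeLie deg S q, derivation deg 1 φ (derivation deg 1 φ y) = 0)
    {p : ℤ} {z : NCSeries X} (hz : z ∈ completeFreeLie deg S p) (hz1 : z ∈ outerFiltration A 1)
    (hdz : derivation deg 1 φ z = 0) :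
    ∃ y ∈ completeFreeLie deg S (p + 1), derivation deg 1 φ y = z := by
  -- The `j`-th remainder `Z j` has at least `j + 1` outer letters in each word, hence the factor
  -- `(j + 1)⁻¹`.
  let H : ℕ → NCSeries X → NCSeries X := fun j z => ((j + 1 : ℕ) : ℚ)⁻¹ • rightNormed deg A
    (derivation deg 0 (fun x => ε x • one) z)
  let Z : ℕ → NCSeries X := fun j =>
    Nat.rec z (fun j z => z - derivation deg 1 φ (H j z)) j
  have hZs : ∀ j, Z (j + 1) = Z j - derivation deg 1 φ (H j (Z j)) := fun j => rfl
  have hH : ∀ j z, z ∈ completeFreeLie deg S p → H j z ∈ completeFreeLie deg S (p + 1) :=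
    fun j z hz => Submodule.smul_mem _ _ (h.rightNormed_contraction_mem hz)
  have hZ : ∀ j, Z j ∈ completeFreeLie deg S p ∧ derivation deg 1 φ (Z j) = 0 ∧
      Z j ∈ outerFiltration A (j + 1) := by
    intro j
    induction j with
    | zero => exact ⟨hz, hdz, hz1⟩
    | succ j ih =>
      obtain ⟨h1, h2, h3⟩ := ih
      rw [hZs]
      refine ⟨sub_mem h1 ?_, ?_, h.sub_derivation_mem (Nat.succ_ne_zero j) h1 h3 h2⟩
      · have := hS _ _ (hH j _ h1)
        rwa [add_sub_cancel_right] at this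
      · rw [map_sub, h2, hdd _ _ (hH j _ h1), sub_zero]
  have hY : ∀ j, H j (Z j) ∈ supp fun w : List X => j + 1 ≤ w.length := by
    intro j
    have h1 : derivation deg 0 (fun x => ε x • one) (Z j) ∈ outerFiltration A (j + 1) := by
      refine derivation_mem_supp deg 0 _ ?_ (hZ j).2.2
      intro u x s t hs hk
      have hx := (h.augmentation_ne_zero x (left_ne_zero_of_mul hs)).1
      rw [outerCount_append, outerCount_cons, if_pos hx] at hk
      rw [outerCount_append, outerCount_append]
      omega
    refine Submodule.smul_mem _ _ (supp_mono (fun w hw => ?_)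
      (rightNormed_mem_supp deg A (fun u v huv hu => ?_) h1))
    · exact le_trans hw (outerCount_le_length A w)
    · rwa [← outerCount_perm A huv]
  -- The infinite sum of all corrections. By `hY`, the `j`-th one does not reach words of length at
  -- most `j`.
  let y : NCSeries X := fun w => ∑ j ∈ Finset.range w.length, H j (Z j) w
  have hy : ∀ N (w : List X), w.length ≤ N →
      y w = (∑ j ∈ Finset.range N, H j (Z j) : NCSeries X) w := by
    intro N w hw
    rw [sum_apply]
    refine Finset.sum_subset (Finset.range_subset_range.2 hw) fun j _ hj => ?_
    refine eq_zero_of_mem_supp (hY j) ?_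
    rw [Finset.mem_range] at hj
    omega
  refine ⟨y, fun n => ?_, ?_⟩
  · have : lengthPart n y = lengthPart n (∑ j ∈ Finset.range n, H j (Z j)) := by
      ext w
      rw [lengthPart_apply, lengthPart_apply]
      split_ifs with hw
      · exact hy n w hw.le
      · rfl
    rw [this]
    exact sum_mem (fun j _ => hH j _ (hZ j).1) n
  · ext w
    have h1 : y - ∑ j ∈ Finset.range w.length, H j (Z j) ∈
        supp fun u => w.length + 1 ≤ u.length := by
      intro u hu
      by_contra hlt
      exact hu (by rw [sub_apply, hy w.length u (by omega), sub_self])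
    have h2 : derivation deg 1 φ (y - ∑ j ∈ Finset.range w.length, H j (Z j)) ∈
        supp fun u => w.length + 1 ≤ u.length := by
      refine derivation_mem_supp deg 1 φ ?_ h1
      intro u x s t hs hl
      have : s ≠ [] := fun h0 => hs (h0 ▸ h.apply_nil x)
      have := List.length_pos_iff.2 this
      simp at hl ⊢
      omega
    -- The corrections telescope, leaving the remainder `Z w.length`, whose words are too long to
    -- include `w`.
    have h3 : derivation deg 1 φ (∑ j ∈ Finset.range w.length, H j (Z j)) =
        z - Z w.length := by
      rw [map_sum, show z = Z 0 from rfl, ← Finset.sum_range_sub' Z]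
      exact Finset.sum_congr rfl fun j _ => by rw [hZs, sub_sub_cancel]
    have h4 := eq_zero_of_mem_supp h2 (w := w) (by omega)
    rw [map_sub, h3, sub_apply, sub_apply] at h4
    have h5 : Z w.length w = 0 := eq_zero_of_mem_supp (hZ w.length).2.2 (by
      have := outerCount_le_length A w
      omega)
    rw [h5] at h4
    linarith

end IsTwistedDifferential

end NCSeries

/-! ### Quasi-isomorphisms of chain complexes of vector spaces -/

/-- Injectivity and surjectivity in homology may be tested after an epimorphism onto the test object
`B`. Here this is the projection to `B` from the module `M` of elements of `B` paired with all
possible solutions; the hypotheses say precisely that it is surjective. -/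
theorem ChainComplex.quasiIso_of_elements {K L : ChainComplex (ModuleCat.{0} ℚ) ℤ} (φ : K ⟶ L)
    (hinj : ∀ (p : ℤ) (x : K.X p) (y : L.X (p + 1)), (K.d p (p - 1)).hom x = 0 →
      (φ.f p).hom x = (L.d (p + 1) p).hom y → ∃ x', (K.d (p + 1) p).hom x' = x)
    (hsurj : ∀ (p : ℤ) (y : L.X p), (L.d p (p - 1)).hom y = 0 → ∃ (x : K.X p) (y' : L.X (p + 1)),
      (K.d p (p - 1)).hom x = 0 ∧ y = (φ.f p).hom x + (L.d (p + 1) p).hom y') :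
    QuasiIso φ := by
  refine ⟨fun p => ?_⟩
  rw [quasiIsoAt_iff_isIso_homologyMap]
  have hprev : (ComplexShape.down ℤ).prev p = p + 1 := by simp
  have hnext : (ComplexShape.down ℤ).next p = p - 1 := by simp
  have : Mono (HomologicalComplex.homologyMap φ p) := by
    rw [HomologicalComplex.mono_homologyMap_iff_up_to_refinements φ _ p _ hprev hnext]
    intro B x hx y hy
    let M : Submodule ℚ (B × K.X (p + 1)) :=
      LinearMap.eqLocus (x.hom ∘ₗ LinearMap.fst ℚ _ _)
        ((K.d (p + 1) p).hom ∘ₗ LinearMap.snd ℚ _ _)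
    refine ⟨ModuleCat.of ℚ M, ModuleCat.ofHom (LinearMap.fst ℚ _ _ ∘ₗ M.subtype), ?_,
      ModuleCat.ofHom (LinearMap.snd ℚ _ _ ∘ₗ M.subtype), ?_⟩
    · rw [ModuleCat.epi_iff_surjective]
      intro b
      obtain ⟨x', hx'⟩ := hinj p (x.hom b) (y.hom b)
        (congrArg (fun f => f.hom b) hx) (congrArg (fun f => f.hom b) hy)
      exact ⟨⟨(b, x'), hx'.symm⟩, rfl⟩
    · ext m
      exact m.2
  have : Epi (HomologicalComplex.homologyMap φ p) := by
    rw [HomologicalComplex.epi_homologyMap_iff_up_to_refinements φ _ p _ hprev hnext]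
    intro B y hy
    let M : Submodule ℚ (B × K.X p × L.X (p + 1)) :=
      LinearMap.eqLocus (y.hom ∘ₗ LinearMap.fst ℚ _ _)
        ((φ.f p).hom ∘ₗ LinearMap.fst ℚ _ _ ∘ₗ LinearMap.snd ℚ _ _ +
          (L.d (p + 1) p).hom ∘ₗ LinearMap.snd ℚ _ _ ∘ₗ LinearMap.snd ℚ _ _) ⊓
      LinearMap.ker ((K.d p (p - 1)).hom ∘ₗ LinearMap.fst ℚ _ _ ∘ₗ LinearMap.snd ℚ _ _)
    refine ⟨ModuleCat.of ℚ M, ModuleCat.ofHom (LinearMap.fst ℚ _ _ ∘ₗ M.subtype), ?_,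
      ModuleCat.ofHom (LinearMap.fst ℚ _ _ ∘ₗ LinearMap.snd ℚ _ _ ∘ₗ M.subtype), ?_,
      ModuleCat.ofHom (LinearMap.snd ℚ _ _ ∘ₗ LinearMap.snd ℚ _ _ ∘ₗ M.subtype), ?_⟩
    · rw [ModuleCat.epi_iff_surjective]
      intro b
      obtain ⟨x, y', hx, hy'⟩ := hsurj p (y.hom b) (congrArg (fun f => f.hom b) hy)
      exact ⟨⟨(b, x, y'), hy', hx⟩, rfl⟩
    · ext m
      exact m.2.2
    · ext m
      exact m.2.1
  exact isIso_of_mono_of_epi _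

/-! ### Splitting off the sub DGL on the generators in `A` -/

namespace CompleteFreeDGL

variable {X Y : Type}

theorem chainComplex_d_apply {deg : X → ℤ} {S : Set X} (D : CompleteFreeDGL deg S) {p q : ℤ}
    (h : q + 1 = p) (x : completeFreeLie deg S p) :
    ((D.chainComplex.d p q).hom x : completeFreeLie deg S q).1 = (D.d p x).1 := by
  dsimp only [chainComplex]
  rw [dif_pos h]
  rfl

theorem Hom.isQuasiIso_of_elements {degX : X → ℤ} {degY : Y → ℤ} {S : Set X} {T : Set Y}
    {D : CompleteFreeDGL degX S} {E : CompleteFreeDGL degY T} (φ : Hom D E)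
    (hinj : ∀ (p : ℤ) (x : completeFreeLie degX S p) (y : completeFreeLie degY T (p + 1)),
      D.d p x = 0 → (φ.toFun p x).1 = (E.d (p + 1) y).1 →
      ∃ x' : completeFreeLie degX S (p + 1), (D.d (p + 1) x').1 = x.1)
    (hsurj : ∀ (p : ℤ) (y : completeFreeLie degY T p), E.d p y = 0 →
      ∃ (x : completeFreeLie degX S p) (y' : completeFreeLie degY T (p + 1)),
        D.d p x = 0 ∧ y.1 = (φ.toFun p x).1 + (E.d (p + 1) y').1) : φ.IsQuasiIso := by
  refine ChainComplex.quasiIso_of_elements φ.chainMap ?_ ?_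
  · intro p x y hx hy
    have hx' : D.d p x = 0 := by
      apply Subtype.ext
      rw [← D.chainComplex_d_apply (sub_add_cancel p 1) x]
      exact congrArg Subtype.val hx
    obtain ⟨x', h⟩ := hinj p x y hx' ((congrArg Subtype.val hy).trans
      (E.chainComplex_d_apply rfl y))
    exact ⟨x', Subtype.ext ((D.chainComplex_d_apply rfl x').trans h)⟩
  · intro p y hy
    have hy' : E.d p y = 0 := by
      apply Subtype.ext
      rw [← E.chainComplex_d_apply (sub_add_cancel p 1) y]
      exact congrArg Subtype.val hy
    obtain ⟨x, y', hx, h⟩ := hsurj p y hy'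
    refine ⟨x, y', ?_, Subtype.ext (h.trans ?_)⟩
    · apply Subtype.ext
      refine (D.chainComplex_d_apply (sub_add_cancel p 1) x).trans ?_
      exact congrArg Subtype.val hx
    · exact congrArg (fun z => (φ.toFun p x).1 + z) (E.chainComplex_d_apply rfl y').symm

open NCSeries

variable {deg : X → ℤ} {A S : Set X} [Fintype X] {a : X} {ε : X → ℚ} {φ : X → NCSeries X}

/-- The inner part retracts the large complex onto the small one, and the complementary subcomplex
is acyclic by `exists_derivation_eq`. -/
theorem inclusion_isQuasiIso (hφ : IsTwistedDifferential deg A a ε φ) (D : CompleteFreeDGL deg A)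
    (E : CompleteFreeDGL deg S) (hAS : A ⊆ S)
    (hd : ∀ (p : ℤ) (x : completeFreeLie deg A p),
      (D.d p x).1 = (E.d p ⟨x.1, completeFreeLie_mono deg hAS p x.2⟩).1)
    (hE : ∀ x (hx : x ∈ S), (E.d (deg x) ⟨letter x, letter_mem hx rfl⟩).1 = φ x)
    (hcont : ∀ p N (f : completeFreeLie deg S p), f.1 ∈ supp (fun w => N ≤ w.length) →
      (E.d p f).1 ∈ supp fun w => N ≤ w.length) :
    (inclusion D E hAS hd).IsQuasiIso := by
  have hEd := d_eq_derivation E hφ.mem_lie hE hcont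
  have hDd : ∀ p x, (D.d p x).1 = derivation deg 1 φ x.1 := fun p x => (hd p x).trans (hEd p _)
  have hin : ∀ {p} {x : NCSeries X}, x ∈ completeFreeLie deg A p →
      derivation deg 1 φ x ∈ supp fun w => ∀ y ∈ w, y ∈ A := fun {p x} hx => by
    rw [← hDd p ⟨x, hx⟩]
    exact completeFreeLie_le_supp_letters _ (D.d p _).2
  refine Hom.isQuasiIso_of_elements _ ?_ ?_
  · intro p x y _ hy
    have hy' : x.1 = derivation deg 1 φ y.1 := Eq.trans hy (hEd _ y)
    -- The inner part of a primitive is again a primitive: the difference of `x` and its boundary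
    -- has only words in `A`, yet each of its words has an outer letter.
    refine ⟨⟨innerPart A y.1, innerPart_mem y.2⟩, ?_⟩
    rw [hDd, eq_comm, ← sub_eq_zero]
    refine eq_zero_of_inner_of_outer (A := A) (sub_mem (completeFreeLie_le_supp_letters _ x.2)
      (hin (innerPart_mem y.2))) ?_
    rw [hy', ← map_sub]
    exact hφ.derivation_mem_outerFiltration (sub_innerPart_mem y.1)
  · intro p z hz
    have hz' : derivation deg 1 φ z.1 = 0 := by rw [← hEd, hz]; rfl
    have hr : innerPart A z.1 ∈ completeFreeLie deg A p := innerPart_mem z.2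
    -- The boundary of the inner part is inner, and it is minus the boundary of the outer part,
    -- hence zero.
    have h0 : derivation deg 1 φ (innerPart A z.1) = 0 := by
      refine eq_zero_of_inner_of_outer (hin hr) ?_
      have := neg_mem (hφ.derivation_mem_outerFiltration (sub_innerPart_mem (A := A) z.1))
      rwa [map_sub, hz', zero_sub, neg_neg] at this
    obtain ⟨y, hy, hy'⟩ := hφ.exists_derivation_eq (S := S)
      (fun q y hy => by rw [← hEd q ⟨y, hy⟩]; exact (E.d q _).2)
      (fun q y hy => by
        rw [← hEd q ⟨y, hy⟩, ← hEd (q - 1) (E.d q ⟨y, hy⟩), E.d_d]; rfl)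
      (sub_mem z.2 (completeFreeLie_mono deg hAS p hr)) (sub_innerPart_mem z.1)
      (by rw [map_sub, hz', h0, sub_zero])
    refine ⟨⟨_, hr⟩, ⟨y, hy⟩, Subtype.ext ((hDd p _).trans h0), ?_⟩
    rw [hEd]
    show z.1 = innerPart A z.1 + derivation deg 1 φ y
    rw [hy', add_sub_cancel]

end CompleteFreeDGL

/-! ### The path component of a vertex -/

open NCSeries

/-- Any vertex of `σ` is joined by an edge of `σ` to a vertex of `τ`. Consequently the boundary of a
simplex outside `K_a` involves no generator of `K_a`. -/
theorem mem_pathComponentComplex_of_subset {n : ℕ}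
    {K : PreAbstractSimplicialComplex (Fin (n + 1))} {a : Fin (n + 1)} {σ τ : Face n}
    (hσ : σ ∈ complexGens K) (hτ : τ ∈ complexGens (pathComponentComplex K a)) (h : τ.1 ⊆ σ.1) :
    σ ∈ complexGens (pathComponentComplex K a) := by
  obtain ⟨v, hv⟩ := τ.2
  refine ⟨hσ, fun w hw => (hτ.2 v hv).tail ?_⟩
  refine (K.isRelLowerSet_faces hσ).2 ?_ (by simp)
  intro u hu
  rcases Finset.mem_insert.1 hu with rfl | hu
  · exact h hv
  · rwa [Finset.mem_singleton.1 hu]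

theorem card_of_boundaryCoeff_ne_zero {n : ℕ} {σ τ : Face n} (h : boundaryCoeff σ τ ≠ 0) :
    σ.1.card = τ.1.card + 1 ∧ τ.1 ⊆ σ.1 := by
  obtain ⟨i, hi, hne⟩ := Finset.exists_ne_zero_of_sum_ne_zero h
  split_ifs at hne with h1
  · rw [h1, Finset.card_erase_add_one hi]
    exact ⟨rfl, Finset.erase_subset _ _⟩
  · exact absurd rfl hne

/-- The sum of the coefficients of the vertices in a simplicial boundary is zero. -/
theorem sum_vertex_boundaryCoeff {n : ℕ} (σ : Face n) :
    ∑ τ : Face n, (if τ.1.card = 1 then boundaryCoeff σ τ else 0) = 0 := by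
  -- Only an edge has vertices in its boundary: omitting its smaller end gives the sign `+1`,
  -- omitting the larger one `-1`.
  by_cases hc : σ.1.card = 2
  · have h1 : ∀ τ : Face n, (if τ.1.card = 1 then boundaryCoeff σ τ else 0) =
        ∑ i ∈ σ.1, if τ.1 = σ.1.erase i then (-1 : ℚ) ^ (σ.1.filter (· < i)).card else 0 := by
      intro τ
      split_ifs with h
      · rfl
      · by_contra hne
        have := (card_of_boundaryCoeff_ne_zero (Ne.symm hne)).1
        omega
    simp only [h1]
    rw [Finset.sum_comm]
    have h2 : ∀ i ∈ σ.1, ∑ τ : Face n,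
        (if τ.1 = σ.1.erase i then (-1 : ℚ) ^ (σ.1.filter (· < i)).card else 0) =
        (-1 : ℚ) ^ (σ.1.filter (· < i)).card := by
      intro i hi
      have hne : (σ.1.erase i).Nonempty := by
        rw [← Finset.card_pos, Finset.card_erase_of_mem hi, hc]; norm_num
      rw [Finset.sum_eq_single ⟨σ.1.erase i, hne⟩]
      · simp
      · intro τ _ hτ
        exact if_neg fun h => hτ (Subtype.ext h)
      · intro h; exact absurd (Finset.mem_univ _) h
    rw [Finset.sum_congr rfl h2]
    obtain ⟨u, v, huv, hσ⟩ := Finset.card_eq_two.1 hc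
    rw [hσ, Finset.sum_pair huv]
    rcases lt_or_gt_of_ne huv with h | h
    · simp [Finset.filter_insert, Finset.filter_singleton, h, not_lt.2 h.le]
    · simp [Finset.filter_insert, Finset.filter_singleton, h, not_lt.2 h.le]
  · refine Finset.sum_eq_zero fun τ _ => ?_
    split_ifs with h
    · by_contra hne
      have := (card_of_boundaryCoeff_ne_zero hne).1
      omega
    · rfl

theorem NCSeries.bracket_letter_letter_singleton {X : Type} (p q : ℤ) (x y z : X) :
    bracket p q (letter x) (letter y) [z] = 0 := by
  simp [bracket, mul_cons_shift, mul_nil, letter_nil]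

/-! ### The twisted differential of a simplicial complex -/

namespace CompatibleModels

variable (M : CompatibleModels) {n : ℕ} (K : PreAbstractSimplicialComplex (Fin (n + 1)))

/-- The continuity that `d_eq_derivation` needs, inherited from `𝔏_n`, where every differential
preserves the filtration by bracket length. -/
theorem supp_length_d (p : ℤ) (N : ℕ) (f : completeFreeLie faceDegree (complexGens K) p)
    (hf : f.1 ∈ supp fun w => N ≤ w.length) :
    ((M.ofComplex K).d p f).1 ∈ supp fun w => N ≤ w.length := by
  intro w hw
  by_contra hlt
  apply hw
  have h1 := (M.model n).lengthPart_d_eq_zero N p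
    ⟨f.1, completeFreeLie_mono faceDegree (Set.subset_univ _) p f.2⟩ (fun k hk => by
      ext u
      rw [lengthPart_apply]
      split_ifs with h
      · exact eq_zero_of_mem_supp hf (by omega)
      · rfl) w.length (by omega)
  have h2 := congrFun h1 w
  rw [lengthPart_apply, if_pos rfl] at h2
  exact h2

open scoped Classical in
/-- The values on generators of the differential of `(𝔏(K), ∂_a)`, extended to the simplices that
are not in `K`. -/
def twistedBoundary (a : Fin (n + 1)) (σ : Face n) : NCSeries (Face n) :=
  (if σ ∈ complexGens K then ((M.model n).d (faceDegree σ) (simplexGen σ)).1 else 0) +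
    bracket (-1) (faceDegree σ) (letter (vertexFace a)) (letter σ)

-- Everything rests on `d_gen_mem`, by which the boundary of a simplex involves only its faces, and
-- on the linear part being the simplicial boundary. The functional `ε` is the sum of the
-- coordinates at the vertices of `K_a`.
open scoped Classical in
theorem isTwistedDifferential (a : Fin (n + 1)) (ha : {a} ∈ K.faces) :
    IsTwistedDifferential faceDegree (complexGens (pathComponentComplex K a)) (vertexFace a)
      (fun τ => if τ ∈ complexGens (pathComponentComplex K a) ∧ τ.1.card = 1 then 1 else 0)
      (M.twistedBoundary K a) where
  mem_lie σ := by
    refine add_mem ?_ ?_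
    · split_ifs
      · exact ((M.model n).d _ _).2
      · exact zero_mem _
    · rw [show faceDegree σ - 1 = -1 + faceDegree σ by ring]
      exact bracket_mem (letter_mem (Set.mem_univ _) (faceDegree_vertexFace a))
        (letter_mem (Set.mem_univ _) rfl)
  inner σ hσ := by
    have ha' : vertexFace a ∈ complexGens (pathComponentComplex K a) :=
      mem_pathComponentComplex K a ha
    have happ : ∀ u v : List (Face n),
        (∀ y ∈ u, y ∈ complexGens (pathComponentComplex K a)) →
        (∀ y ∈ v, y ∈ complexGens (pathComponentComplex K a)) →
        ∀ y ∈ u ++ v, y ∈ complexGens (pathComponentComplex K a) := fun u v hu hv y hy =>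
      (List.mem_append.1 hy).elim (hu y) (hv y)
    refine add_mem ?_ (bracket_mem_supp happ happ _ _ (letter_mem_supp (by simpa using ha'))
      (letter_mem_supp (by simpa using hσ)))
    rw [if_pos (show σ ∈ complexGens K from hσ.1)]
    refine supp_mono ?_ (completeFreeLie_le_supp_letters _ (M.d_gen_mem σ))
    intro w hw τ hτ
    exact ((pathComponentComplex K a).isRelLowerSet_faces hσ).2 (hw τ hτ) τ.2
  outer σ hσ := by
    rw [twistedBoundary, add_sub_cancel_right]
    split_ifs with hK
    · refine supp_mono ?_ (completeFreeLie_le_supp _ (M.d_gen_mem σ))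
      rintro w ⟨hw, -, hw'⟩
      exact ⟨hw, fun τ hτ h => hσ (mem_pathComponentComplex_of_subset hK h (hw' τ hτ))⟩
    · exact zero_mem _
  augmentation_base := if_pos ⟨mem_pathComponentComplex K a ha, by simp [vertexFace]⟩
  augmentation_ne_zero τ hτ := by
    obtain ⟨h1, h2⟩ := (ite_ne_right_iff.1 hτ).1
    exact ⟨h1, by rw [faceDegree, h2]; norm_num⟩
  augmentation_boundary σ := by
    have h1 : ∀ τ, M.twistedBoundary K a σ [τ] =
        if σ ∈ complexGens K then boundaryCoeff σ τ else 0 := by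
      intro τ
      rw [twistedBoundary, NCSeries.add_apply, NCSeries.bracket_letter_letter_singleton, add_zero]
      split_ifs
      · exact M.linearPart n σ τ
      · rfl
    simp only [h1]
    by_cases hK : σ ∈ complexGens K
    -- The faces of `σ` lie all in `K_a` or all outside it. In the first case the sum is the
    -- augmentation of a simplicial boundary, in the second every term is zero.
    · by_cases hσ : σ ∈ complexGens (pathComponentComplex K a)
      · refine Eq.trans ?_ (sum_vertex_boundaryCoeff σ)
        refine Finset.sum_congr rfl fun τ _ => ?_
        rw [if_pos hK]
        by_cases h : boundaryCoeff σ τ = 0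
        · simp [h]
        · have : τ ∈ complexGens (pathComponentComplex K a) :=
            ((pathComponentComplex K a).isRelLowerSet_faces hσ).2
              (card_of_boundaryCoeff_ne_zero h).2 τ.2
          simp [this]
      · refine Finset.sum_eq_zero fun τ _ => ?_
        rw [if_pos hK]
        by_cases h : boundaryCoeff σ τ = 0
        · simp [h]
        · rw [if_neg, zero_mul]
          exact fun hτ => hσ (mem_pathComponentComplex_of_subset hK hτ.1
            (card_of_boundaryCoeff_ne_zero h).2)
    · simp [hK]

end CompatibleModels

end

theorem mainTheorem11 (𝔏 : CompatibleModels) (n : ℕ)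
    (K : PreAbstractSimplicialComplex (Fin (n + 1))) (a : Fin (n + 1)) (ha : {a} ∈ K.faces) :
    (𝔏.componentInclusion K a ha).IsQuasiIso := by
  refine CompleteFreeDGL.inclusion_isQuasiIso (𝔏.isTwistedDifferential K a ha) _ _ _ _ ?_ ?_
  · intro σ hσ
    rw [CompatibleModels.twistedBoundary, if_pos hσ]
    rfl
  · intro p N f hf
    -- The remaining summand `ad_a` does not shorten words.
    refine add_mem (𝔏.supp_length_d K p N f hf) ?_
    exact NCSeries.bracket_mem_supp (Q := fun _ => True) (R := fun w => N ≤ w.length)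
      (fun u v _ hv => by simp; omega) (fun u v hv _ => by simp; omega) _ _
      (fun _ _ => trivial) hf
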